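/- **Product rule for the $F$-functional calculus in dimension five.** Let $\mathbb{R}_5$ be the real Clifford algebra with units $e_1,\dots,e_5$ ($e_i^2=-1$, $e_ie_j=-e_je_i$ for $i\neq j$), with basis $e_A$, $A\subseteq\{1,\dots,5\}$. Identify $x\in\mathbb{R}^6$ with the paravector $x_0+\sum_{j=1}^5x_je_j$, let $\mathbb{S}$ be the set of $J=\sum_{j=1}^5 J_je_j$ with $\sum_j J_j^2=1$, and $\mathbb{C}_J=\{u+Jv:u,v\in\mathbb{R}\}$. An open set $W\subseteq\mathbb{R}^6$ is axially symmetric if $u+Iv\in W$ with $I\in\mathbb{S}$ implies $u+Jv\in W$ for all $J\in\mathbb{S}$. On such a $W$, a function $f:W\to\mathbb{R}_5$ is left slice hyperholomorphic if $f(u+Jv)=\alpha(u,v)+J\beta(u,v)$ for all $J\in\mathbb{S}$, with differentiable $\mathbb{R}_5$-valued $\alpha$ (even in $v$) and $\beta$ (odd in $v$) such that $\partial_u\alpha=\partial_v\beta$ and $\partial_v\alpha=-\partial_u\beta$; it is intrinsic if $\alpha,\beta$ can be taken real-valued. A slice Cauchy domain is an axially symmetric open set $U$ such that, for every $J\in\mathbb{S}$,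 the boundary of $U\cap\mathbb{C}_J$ in $\mathbb{C}_J$ is a finite union of nonintersecting piecewise $C^1$ Jordan curves. Let $V$ be a real Banach space, and let $\mathcal{B}(V_5)$ be the algebra of operators $\sum_A T_Ae_A$ with $T_A$ bounded linear operators on $V$. Let $T=T_0+\sum_{j=1}^5e_jT_j$ with pairwise commuting bounded operators $T_0,\dots,T_5$ on $V$, and $\overline T=T_0-\sum_{j=1}^5e_jT_j$. For $s\in\mathbb{R}^6$ put $\mathcal{Q}_{c,s}(T)=s^2\mathcal I-s(T+\overline T)+T\overline T$, and let $\sigma_S(T)$ be the set of $s$ for which $\mathcal{Q}_{c,s}(T)$ is not invertible. For $s\notin\sigma_S(T)$ and $Q=\mathcal{Q}_{c,s}(T)$ define the left resolvent operators $$K^L_{1}=(s\mathcal I-\overline T)Q^{-1},\quad K^L_{\mathcal D}=-4Q^{-1},\quad K^L_{\Delta}=-8(s\mathcal I-\overline T)Q^{-2},\quad K^L_{\Delta\mathcal D}=16Q^{-2},\quad K^L_{\Delta^2}=64(s\mathcal I-\overline T)Q^{-3},$$ and the right ones $K^R_P$ by the same formulas with the factor $s\mathcal I-\overline T$ on the right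 of the power of $Q^{-1}$. Let $P$ be one of $1,\mathcal D,\Delta,\Delta\mathcal D,\Delta^2$ (where $\mathcal D=\partial_{x_0}+\sum_{j=1}^5e_j\partial_{x_j}$ and $\Delta$ is the Laplacian of $\mathbb{R}^6$). For $f$ left slice hyperholomorphic on an axially symmetric open set $W\supseteq\sigma_S(T)$, the operator $(Pf)(T)\in\mathcal{B}(V_5)$ is $$(Pf)(T)=\frac1{2\pi}\int_{\partial(U\cap\mathbb{C}_J)}K^L_P(s,T)\,ds_J\,f(s),\qquad ds_J=ds\,(-J),$$ for a bounded slice Cauchy domain $U$ with $\sigma_S(T)\subset U$, $\overline U\subset W$, and $J\in\mathbb{S}$, the boundary being positively oriented. For intrinsic $f$ one may also use $\frac1{2\pi}\int_{\partial(U\cap\mathbb{C}_J)}f(s)\,ds_J\,K^R_P(s,T)$. For $P=1$ write $f(T)$. Let $f$ be intrinsic slice hyperholomorphic on an axially symmetric open set $W_f\supseteq\sigma_S(T)$, and let $g$ be left slice hyperholomorphic on an axially symmetric open set $W_g\supseteq\sigma_S(T)$. Then the pointwise product $fg$ is left slice hyperholomorphic on $W_f\cap W_g$, and, whatever $U$ and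 $J$ (and, for $f$, whichever of the two forms) are used for each of the operators involved, $$\Delta^2(fg)(T)=(\Delta^2f)(T)\,g(T)+f(T)\,(\Delta^2g)(T)+(\Delta f)(T)\,(\Delta g)(T)-(\Delta\mathcal{D}f)(T)\,(\mathcal{D}g)(T)-(\mathcal{D}f)(T)\,(\Delta\mathcal{D}g)(T).$$ -/

import Mathlib

noncomputable section

/-- The sign in `e_A e_B = sgn A B • e_{A ∆ B}`, for generators with `e_i e_j = - e_j e_i`
(`i ≠ j`) and `e_i ^ 2 = -1`: one factor `-1` for every pair `i ∈ A`, `j ∈ B` with `j ≤ i`. -/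
def cliffSign (A B : Finset (Fin 5)) : ℤ :=
  ∏ i ∈ A, ∏ j ∈ B, if j ≤ i then -1 else 1

/-- Elements `∑_A x_A e_A`, `A ⊆ {1,…,5}`, with coefficients `x_A` in `𝔄` that commute with the
`e_A`, i.e. `𝔄 ⊗ ℝ₅`.  The real Clifford algebra `ℝ₅` is `Cliff ℝ`; the algebra `𝓑(V₅)` of the
operators `∑_A T_A e_A`, `T_A ∈ 𝓑(V)`, is `Cliff (V →L[ℝ] V)`. -/
def Cliff (𝔄 : Type*) : Type _ := Finset (Fin 5) → 𝔄

namespace Cliff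

instance instNormedAddCommGroup {𝔄 : Type*} [NormedAddCommGroup 𝔄] :
    NormedAddCommGroup (Cliff 𝔄) :=
  inferInstanceAs (NormedAddCommGroup (Finset (Fin 5) → 𝔄))

instance instNormedSpace {𝔄 : Type*} [NormedAddCommGroup 𝔄] [NormedSpace ℝ 𝔄] :
    NormedSpace ℝ (Cliff 𝔄) :=
  inferInstanceAs (NormedSpace ℝ (Finset (Fin 5) → 𝔄))

instance instCompleteSpace {𝔄 : Type*} [NormedAddCommGroup 𝔄] [CompleteSpace 𝔄] :
    CompleteSpace (Cliff 𝔄) :=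
  inferInstanceAs (CompleteSpace (Finset (Fin 5) → 𝔄))

/-- `a e_A`. -/
def mono {𝔄 : Type*} [Zero 𝔄] (A : Finset (Fin 5)) (a : 𝔄) : Cliff 𝔄 := Pi.single A a

instance instMul {𝔄 : Type*} [Ring 𝔄] : Mul (Cliff 𝔄) where
  mul a b := fun C => ∑ A, cliffSign A (symmDiff A C) • (a A * b (symmDiff A C))

instance instOne {𝔄 : Type*} [Ring 𝔄] : One (Cliff 𝔄) where
  one := mono ∅ 1

end Cliff

theorem cliff_mul_apply {𝔄 : Type*} [Ring 𝔄] (a b : Cliff 𝔄) (C : Finset (Fin 5)) :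
    (a * b) C = ∑ A, cliffSign A (symmDiff A C) • (a A * b (symmDiff A C)) := rfl

theorem cliff_one_empty {𝔄 : Type*} [Ring 𝔄] : (1 : Cliff 𝔄) ∅ = 1 := by
  change (Pi.single ∅ 1 : Finset (Fin 5) → 𝔄) ∅ = 1
  simp

theorem cliff_one_ne {𝔄 : Type*} [Ring 𝔄] {A : Finset (Fin 5)} (hA : A ≠ ∅) :
    (1 : Cliff 𝔄) A = 0 := by
  change (Pi.single ∅ 1 : Finset (Fin 5) → 𝔄) A = 0
  simp [hA]

theorem prod_symmDiff_of_sq (g : Fin 5 → ℤ) (hg : ∀ i, g i * g i = 1) (A B : Finset (Fin 5)) :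
    ∏ i ∈ symmDiff A B, g i = (∏ i ∈ A, g i) * ∏ i ∈ B, g i := by
  have h1 : ∀ S : Finset (Fin 5), ∏ i ∈ S, g i = ∏ i, if i ∈ S then g i else 1 := fun S => by
    simp
  rw [h1, h1 A, h1 B, ← Finset.prod_mul_distrib]
  refine Finset.prod_congr rfl fun i _ => ?_
  by_cases hA : i ∈ A <;> by_cases hB : i ∈ B <;> simp [Finset.mem_symmDiff, hA, hB, hg]

theorem cliffSign_symmDiff_left (A B C : Finset (Fin 5)) :
    cliffSign (symmDiff A B) C = cliffSign A C * cliffSign B C := by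
  refine prod_symmDiff_of_sq _ (fun i => ?_) A B
  rw [← Finset.prod_mul_distrib]
  exact Finset.prod_eq_one fun j _ => by split_ifs <;> norm_num

theorem cliffSign_symmDiff_right (A B C : Finset (Fin 5)) :
    cliffSign A (symmDiff B C) = cliffSign A B * cliffSign A C := by
  unfold cliffSign
  rw [← Finset.prod_mul_distrib]
  refine Finset.prod_congr rfl fun i _ => prod_symmDiff_of_sq _ (fun j => ?_) B C
  split_ifs <;> norm_num

theorem cliff_mul_assoc {𝔄 : Type*} [Ring 𝔄] (a b c : Cliff 𝔄) : a * b * c = a * (b * c) := by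
  funext D
  simp only [cliff_mul_apply, Finset.sum_mul, Finset.mul_sum, Finset.smul_sum]
  rw [Finset.sum_comm]
  refine Finset.sum_congr rfl fun A _ => ?_
  refine Fintype.sum_equiv (symmDiff_left_involutive A).toPerm _ _ fun B => ?_
  have e1 : symmDiff (symmDiff B A) (symmDiff A D) = symmDiff B D := by
    rw [symmDiff_assoc, symmDiff_symmDiff_cancel_left]
  have e2 : symmDiff A B = symmDiff B A := symmDiff_comm A B
  simp only [Function.Involutive.coe_toPerm, e1, e2, smul_mul_assoc, mul_smul_comm, smul_smul,
    mul_assoc]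
  congr 1
  have h1 : cliffSign A (symmDiff A D) =
      cliffSign A (symmDiff B A) * cliffSign A (symmDiff B D) := by
    rw [← cliffSign_symmDiff_right, symmDiff_comm B A, symmDiff_assoc,
      symmDiff_symmDiff_cancel_left]
  have h2 : cliffSign B (symmDiff B D) =
      cliffSign A (symmDiff B D) * cliffSign (symmDiff B A) (symmDiff B D) := by
    rw [← cliffSign_symmDiff_left, symmDiff_comm B A, symmDiff_symmDiff_cancel_left]
  rw [h1, h2]
  ring

instance Cliff.instRing {𝔄 : Type*} [NormedRing 𝔄] : Ring (Cliff 𝔄) where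
  __ := (inferInstance : AddCommGroup (Cliff 𝔄))
  mul_assoc := cliff_mul_assoc
  one_mul a := by
    funext C
    rw [cliff_mul_apply, Finset.sum_eq_single ∅]
    · rw [cliff_one_empty, ← Finset.bot_eq_empty, bot_symmDiff]
      simp [cliffSign]
    · intro A _ hA
      rw [cliff_one_ne hA]
      simp
    · simp
  mul_one a := by
    funext C
    rw [cliff_mul_apply, Finset.sum_eq_single C]
    · rw [symmDiff_self, Finset.bot_eq_empty, cliff_one_empty]
      simp [cliffSign]
    · intro A _ hA
      rw [cliff_one_ne fun h => hA (symmDiff_eq_bot.mp h)]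
      simp
    · simp
  left_distrib a b c := by
    funext C
    change _ = (a * b) C + (a * c) C
    simp only [cliff_mul_apply, ← Finset.sum_add_distrib, ← smul_add, ← mul_add]
    rfl
  right_distrib a b c := by
    funext C
    change _ = (a * c) C + (b * c) C
    simp only [cliff_mul_apply, ← Finset.sum_add_distrib, ← smul_add, ← add_mul]
    rfl
  zero_mul a := by
    funext C
    simp only [cliff_mul_apply]
    exact Finset.sum_eq_zero fun A _ => by
      rw [show ((0 : Cliff 𝔄) A) = 0 from rfl]; simp
  mul_zero a := by
    funext C
    simp only [cliff_mul_apply]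
    exact Finset.sum_eq_zero fun A _ => by
      rw [show ((0 : Cliff 𝔄) (symmDiff A C)) = 0 from rfl]; simp

/-- The paravector `x₀ + ∑_j e_j x_j`. -/
def paravector {𝔄 : Type*} [NormedRing 𝔄] (x : Fin 6 → 𝔄) : Cliff 𝔄 :=
  Cliff.mono ∅ (x 0) + ∑ j : Fin 5, Cliff.mono {j} (x j.succ)

/-- The conjugate paravector `x₀ - ∑_j e_j x_j`. -/
def paravectorConj {𝔄 : Type*} [NormedRing 𝔄] (x : Fin 6 → 𝔄) : Cliff 𝔄 :=
  Cliff.mono ∅ (x 0) - ∑ j : Fin 5, Cliff.mono {j} (x j.succ)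

/-- `ℝ⁶`, whose points are identified with the paravectors of `ℝ₅`. -/
abbrev R6 : Type := EuclideanSpace ℝ (Fin 6)

/-- The point of `ℝ⁶` as an element of `ℝ₅`. -/
def R6.toCliff (x : R6) : Cliff ℝ := paravector fun i => x i

/-- A Clifford number as an operator: `∑_A a_A e_A ↦ ∑_A (a_A I) e_A`. -/
def Cliff.toOp (V : Type*) [NormedAddCommGroup V] [NormedSpace ℝ V] (a : Cliff ℝ) :
    Cliff (V →L[ℝ] V) :=
  fun A => a A • ContinuousLinearMap.id ℝ V

/-- The sphere `𝕊` of imaginary units. -/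
def imagSphere : Set R6 := {J | J 0 = 0 ∧ ‖J‖ = 1}

/-- The point `u + J v` for `z = u + i v`. -/
def slicePoint (J : R6) (z : ℂ) : R6 := EuclideanSpace.single 0 z.re + z.im • J

/-- `U ∩ ℂ_J`, with `ℂ_J` identified with `ℂ`. -/
def sliceOf (J : R6) (U : Set R6) : Set ℂ := {z | slicePoint J z ∈ U}

/-- Axial symmetry: if `u + I v ∈ U` for one imaginary unit `I`, then `u + J v ∈ U` for all. -/
def AxiallySymmetric (U : Set R6) : Prop :=
  ∀ z : ℂ, ∀ I ∈ imagSphere, ∀ J ∈ imagSphere, slicePoint I z ∈ U → slicePoint J z ∈ U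

/-- The set of all `(u, v)` (as complex numbers `u + i v`) with `u + J v ∈ U` for all `J ∈ 𝕊`. -/
def stemDomain (U : Set R6) : Set ℂ := {z | ∀ J ∈ imagSphere, slicePoint J z ∈ U}

/-- `α`, `β` are differentiable functions of `(u, v)`, even and odd in `v` respectively, and
satisfy the Cauchy-Riemann system. -/
structure IsStemPair {F : Type*} [NormedAddCommGroup F] [NormedSpace ℝ F]
    (S : Set ℂ) (α β : ℂ → F) : Prop where
  diff_left : ∀ z ∈ S, DifferentiableAt ℝ α z
  diff_right : ∀ z ∈ S, DifferentiableAt ℝ β z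
  even : ∀ z ∈ S, α z = α (starRingEnd ℂ z)
  odd : ∀ z ∈ S, β z = -β (starRingEnd ℂ z)
  cr_left : ∀ z ∈ S, fderiv ℝ α z 1 - fderiv ℝ β z Complex.I = 0
  cr_right : ∀ z ∈ S, fderiv ℝ α z Complex.I + fderiv ℝ β z 1 = 0

/-- `f` is left slice hyperholomorphic with domain `U`: `f(u + J v) = α(u, v) + J β(u, v)`. -/
structure IsLeftSliceHyperholomorphic (U : Set R6) (f : R6 → Cliff ℝ) : Prop where
  isOpen : IsOpen U
  symm : AxiallySymmetric U
  rep : ∃ α β : ℂ → Cliff ℝ, IsStemPair (stemDomain U) α β ∧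
    ∀ z ∈ stemDomain U, ∀ J ∈ imagSphere, f (slicePoint J z) = α z + J.toCliff * β z

/-- `f` is intrinsic slice hyperholomorphic with domain `U`: `α` and `β` are real-valued. -/
structure IsIntrinsicSliceHyperholomorphic (U : Set R6) (f : R6 → Cliff ℝ) : Prop where
  isOpen : IsOpen U
  symm : AxiallySymmetric U
  rep : ∃ α β : ℂ → ℝ, IsStemPair (stemDomain U) α β ∧
    ∀ z ∈ stemDomain U, ∀ J ∈ imagSphere,
      f (slicePoint J z) = Cliff.mono ∅ (α z) + J.toCliff * Cliff.mono ∅ (β z)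

/-- A piecewise continuously differentiable closed Jordan curve, parametrized over `[0, 1]`. -/
structure IsJordanCurve (γ : ℝ → ℂ) : Prop where
  continuousOn : ContinuousOn γ (Set.Icc 0 1)
  closed : γ 0 = γ 1
  injOn : Set.InjOn γ (Set.Ico 0 1)
  piecewise : ∃ (n : ℕ) (t : Fin (n + 1) → ℝ), StrictMono t ∧ t 0 = 0 ∧ t (Fin.last n) = 1 ∧
    ∀ i : Fin n, ContDiffOn ℝ 1 γ (Set.Icc (t i.castSucc) (t i.succ))

/-- The boundary of `Ω` is the union of the finitely many nonintersecting piecewise `C¹` Jordan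
curves `γ 0, …, γ (m - 1)`. -/
structure IsJordanBoundary (Ω : Set ℂ) {m : ℕ} (γ : Fin m → ℝ → ℂ) : Prop where
  jordan : ∀ k, IsJordanCurve (γ k)
  disjoint : ∀ k l, k ≠ l → Disjoint (γ k '' Set.Icc 0 1) (γ l '' Set.Icc 0 1)
  union_eq : ⋃ k, γ k '' Set.Icc 0 1 = frontier Ω

/-- The winding number of the cycle `∑_k γ k` around `w`. -/
def windingNumber {m : ℕ} (γ : Fin m → ℝ → ℂ) (w : ℂ) : ℂ :=
  (2 * Real.pi * Complex.I)⁻¹ * ∑ k, ∫ t in (0 : ℝ)..1, deriv (γ k) t / (γ k t - w)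

/-- The cycle is the positively oriented boundary of `Ω`: it winds once around the points of `Ω`
and does not wind around the points outside the closure of `Ω`. -/
def PositivelyOriented (Ω : Set ℂ) {m : ℕ} (γ : Fin m → ℝ → ℂ) : Prop :=
  (∀ w ∈ Ω, windingNumber γ w = 1) ∧ ∀ w ∉ closure Ω, windingNumber γ w = 0

/-- Slice Cauchy domains. -/
structure IsSliceCauchyDomain (U : Set R6) : Prop where
  isOpen : IsOpen U
  symm : AxiallySymmetric U
  boundary : ∀ J ∈ imagSphere,
    ∃ (m : ℕ) (γ : Fin m → ℝ → ℂ), IsJordanBoundary (sliceOf J U) γ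

section Operators

variable {V : Type*} [NormedAddCommGroup V] [NormedSpace ℝ V]

/-- `𝓠_{c,s}(T) = s² I - s (T + T̄) + T T̄`, for `T = T₀ + ∑_j e_j T_j`. -/
def Qc (T : Fin 6 → V →L[ℝ] V) (s : R6) : Cliff (V →L[ℝ] V) :=
  s.toCliff.toOp V ^ 2 - s.toCliff.toOp V * (paravector T + paravectorConj T)
    + paravector T * paravectorConj T

/-- The `S`-spectrum. -/
def sSpectrum (T : Fin 6 → V →L[ℝ] V) : Set R6 := {s | ¬ IsUnit (Qc T s)}

/-- `𝓠_{c,s}(T)⁻¹`, for `s` outside the `S`-spectrum. -/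
def QcInv (T : Fin 6 → V →L[ℝ] V) (s : R6) : Cliff (V →L[ℝ] V) := Ring.inverse (Qc T s)

/-- The left `SC`-resolvent operator `(s I - T̄) 𝓠_{c,s}(T)⁻¹`. -/
def scResolventLeft (T : Fin 6 → V →L[ℝ] V) (s : R6) : Cliff (V →L[ℝ] V) :=
  (s.toCliff.toOp V - paravectorConj T) * QcInv T s

/-- The right `SC`-resolvent operator `𝓠_{c,s}(T)⁻¹ (s I - T̄)`. -/
def scResolventRight (T : Fin 6 → V →L[ℝ] V) (s : R6) : Cliff (V →L[ℝ] V) :=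
  QcInv T s * (s.toCliff.toOp V - paravectorConj T)

/-- The operators `P` of which the functional calculi `f ↦ (P f)(T)` are used: the identity
(`SC`-functional calculus), the Dirac operator `D` and `Δ D` (harmonic functional calculi), the
Laplacian `Δ` of `ℝ⁶` (holomorphic Cliffordian functional calculus of order one) and `Δ²`
(`F`-functional calculus). -/
inductive FineOp : Type
  | id
  | D
  | Δ
  | ΔD
  | ΔΔ

/-- The left resolvent operator of the calculus of `P`.  For `Δ²` it is
`F₅^L(s, T) = γ₅ (s I - T̄) 𝓠_{c,s}(T)⁻³` with `γ₅ = 2⁴ (2!)² = 64`. -/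
def FineOp.resolventLeft (P : FineOp) (T : Fin 6 → V →L[ℝ] V) (s : R6) : Cliff (V →L[ℝ] V) :=
  match P with
  | .id => scResolventLeft T s
  | .D => (-4 : ℝ) • QcInv T s
  | .Δ => (-8 : ℝ) • (scResolventLeft T s * QcInv T s)
  | .ΔD => (16 : ℝ) • QcInv T s ^ 2
  | .ΔΔ => (64 : ℝ) • ((s.toCliff.toOp V - paravectorConj T) * QcInv T s ^ 3)

/-- The right resolvent operator of the calculus of `P`. -/
def FineOp.resolventRight (P : FineOp) (T : Fin 6 → V →L[ℝ] V) (s : R6) : Cliff (V →L[ℝ] V) :=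
  match P with
  | .id => scResolventRight T s
  | .D => (-4 : ℝ) • QcInv T s
  | .Δ => (-8 : ℝ) • (QcInv T s * scResolventRight T s)
  | .ΔD => (16 : ℝ) • QcInv T s ^ 2
  | .ΔΔ => (64 : ℝ) • (QcInv T s ^ 3 * (s.toCliff.toOp V - paravectorConj T))

/-- `(1 / 2π) ∫ K(s) ds_J f(s)` with `ds_J = ds (-J)`, along the image of the cycle `γ` in `ℂ_J`. -/
def leftIntegral (K : R6 → Cliff (V →L[ℝ] V)) (f : R6 → Cliff ℝ) (J : R6)
    {m : ℕ} (γ : Fin m → ℝ → ℂ) : Cliff (V →L[ℝ] V) :=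
  (2 * Real.pi)⁻¹ • ∑ k, ∫ t in (0 : ℝ)..1,
    K (slicePoint J (γ k t)) *
      ((slicePoint J (deriv (γ k) t)).toCliff * (-J.toCliff)).toOp V *
      (f (slicePoint J (γ k t))).toOp V

/-- `(1 / 2π) ∫ f(s) ds_J K(s)` with `ds_J = ds (-J)`, along the image of the cycle `γ` in `ℂ_J`. -/
def rightIntegral (K : R6 → Cliff (V →L[ℝ] V)) (f : R6 → Cliff ℝ) (J : R6)
    {m : ℕ} (γ : Fin m → ℝ → ℂ) : Cliff (V →L[ℝ] V) :=
  (2 * Real.pi)⁻¹ • ∑ k, ∫ t in (0 : ℝ)..1,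
    (f (slicePoint J (γ k t))).toOp V *
      ((slicePoint J (deriv (γ k) t)).toCliff * (-J.toCliff)).toOp V *
      K (slicePoint J (γ k t))

/-- `γ` is the positively oriented boundary of `U ∩ ℂ_J`, where `U` is a bounded slice Cauchy
domain with `σ_S(T) ⊆ U` and closure of `U` in `W`, the domain of the function to be applied
to `T`. -/
structure IsAdmissible (T : Fin 6 → V →L[ℝ] V) (W U : Set R6) (J : R6)
    {m : ℕ} (γ : Fin m → ℝ → ℂ) : Prop where
  cauchy : IsSliceCauchyDomain U
  bounded : Bornology.IsBounded U
  spectrum_subset : sSpectrum T ⊆ U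
  closure_subset : closure U ⊆ W
  unit : J ∈ imagSphere
  boundary : IsJordanBoundary (sliceOf J U) γ
  oriented : PositivelyOriented (sliceOf J U) γ

/-- `A` is the operator `(P f)(T)`, computed by the functional calculus for left slice
hyperholomorphic functions, for the function `f` with domain `W`. -/
def IsLeftCalculus (P : FineOp) (T : Fin 6 → V →L[ℝ] V) (W : Set R6) (f : R6 → Cliff ℝ)
    (A : Cliff (V →L[ℝ] V)) : Prop :=
  ∃ (U : Set R6) (J : R6) (m : ℕ) (γ : Fin m → ℝ → ℂ),
    IsAdmissible T W U J γ ∧ A = leftIntegral (P.resolventLeft T) f J γ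

/-- `A` is the operator `(P f)(T)`, computed by the functional calculus for right slice
hyperholomorphic functions, for the function `f` with domain `W`. -/
def IsRightCalculus (P : FineOp) (T : Fin 6 → V →L[ℝ] V) (W : Set R6) (f : R6 → Cliff ℝ)
    (A : Cliff (V →L[ℝ] V)) : Prop :=
  ∃ (U : Set R6) (J : R6) (m : ℕ) (γ : Fin m → ℝ → ℂ),
    IsAdmissible T W U J γ ∧ A = rightIntegral (P.resolventRight T) f J γ

/-- `A` is the operator `(P f)(T)` for an intrinsic function `f`, which is both left and right
slice hyperholomorphic, so that both forms of the calculus apply to it. -/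
def IsIntrinsicCalculus (P : FineOp) (T : Fin 6 → V →L[ℝ] V) (W : Set R6) (f : R6 → Cliff ℝ)
    (A : Cliff (V →L[ℝ] V)) : Prop :=
  IsLeftCalculus P T W f A ∨ IsRightCalculus P T W f A

end Operators

end

/-! The product rule is the integrated form of a resolvent equation. Put `a = T + T̄`, `b = T T̄`,
`y = T̄`, and let `p`, `r` be the inverses of `z² - z a + b` and `w² - w a + b`. Since `y² = a y -
b`, the functions `(z - y) p` and `(w - y) r` satisfy the ordinary resolvent equation `(z - w) (z -
y) p (w - y) r = (w - y) r - (z - y) p`. Multiplying by `p² + p r + r²` leaves `(w - y) r³ - (z - y)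
p³` on the right, up to `(w - z) (p² r + p r²)`; moving this to the left produces the two terms with
`D` and `ΔD`. This is `FineOp.kernel_resolvent_equation`.

To work with a genuine complex variable, `𝓑(V₅)` is embedded in a complex Banach algebra
(`exists_complex_representation`). There an imaginary unit `J` becomes `j` with `j² = -1`, and the
idempotents `(1 ∓ i j) / 2` split every object on the slice `ℂ_J` into its value at `z` and its
value at `z̄`: kernels, `ds_J`, and slice functions `α + J β`, which become the holomorphic `α + i
β`. The slice domain is symmetric under conjugation, so both parts carry the same integral and `J`
disappears (`rep_leftIntegral`, `rep_rightIntegral`).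

Contour integrals are traded for area integrals `-(1/π) ∫ ∂̄φ F K`, where `φ` is a cutoff equal to
`1` near the spectrum (`cycle_integral_eq`). This follows from the Cauchy–Pompeiu formula and Fubini
and uses of the contour only its winding numbers. The choice of `U`, `J` and `γ` is thereby replaced
by the choice of `φ`, which may be shrunk at will.

For the product, the cutoff `φ` for `f` is taken equal to `1` near the support of the cutoff `ψ` for
`g` (`sum_cutoff_integral_mul`). After the resolvent equation, the term with the kernel at `w`
reproduces `f(w)` by Cauchy–Pompeiu, and the term with the kernel at `z` vanishes because `ψ` does.
-/

open Set Filter Topology MeasureTheory Complex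
open scoped Real Interval ContDiff

/-! ### The Cauchy–Pompeiu formula -/

section Pompeiu

variable {E : Type*} [NormedAddCommGroup E] [NormedSpace ℂ E]

/-- The Wirtinger derivative `∂u/∂w̄ = (∂u/∂x + i ∂u/∂y) / 2`. -/
noncomputable def dbar (u : ℂ → E) (w : ℂ) : E :=
  (2 : ℂ)⁻¹ • (fderiv ℝ u w 1 + I • fderiv ℝ u w I)

theorem continuous_dbar {u : ℂ → E} (hu : ContDiff ℝ 1 u) : Continuous (dbar u) := by
  have h := hu.continuous_fderiv one_ne_zero
  unfold dbar
  fun_prop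

theorem tsupport_dbar_subset (u : ℂ → E) : tsupport (dbar u) ⊆ tsupport u := by
  refine closure_minimal (fun w hw => ?_) (isClosed_tsupport u)
  by_contra h
  refine hw ?_
  have h0 : fderiv ℝ u w = 0 := by
    by_contra h1
    exact h (tsupport_fderiv_subset ℝ (subset_tsupport _ h1))
  simp [dbar, h0]

theorem hasCompactSupport_dbar {u : ℂ → E} (hu : HasCompactSupport u) :
    HasCompactSupport (dbar u) :=
  hu.of_isClosed_subset (isClosed_tsupport _) (tsupport_dbar_subset u)

theorem Filter.EventuallyEq.dbar_eq {u v : ℂ → E} {w : ℂ} (h : u =ᶠ[𝓝 w] v) :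
    dbar u w = dbar v w := by
  simp [dbar, h.fderiv_eq]

theorem dbar_eq_zero_of_differentiableAt {u : ℂ → E} {w : ℂ} (h : DifferentiableAt ℂ u w) :
    dbar u w = 0 := by
  have h1 : fderiv ℝ u w = (fderiv ℂ u w).restrictScalars ℝ :=
    h.hasFDerivAt.restrictScalars ℝ |>.fderiv
  have h2 : fderiv ℂ u w I = I • fderiv ℂ u w 1 := by
    rw [← ContinuousLinearMap.map_smul, smul_eq_mul, mul_one]
  simp [dbar, h1, h2, smul_smul]

theorem dbar_smul {φ : ℂ → ℂ} {h : ℂ → E} {w : ℂ} (hφ : DifferentiableAt ℝ φ w)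
    (hh : DifferentiableAt ℂ h w) : dbar (fun z => φ z • h z) w = dbar φ w • h w := by
  have h0 := dbar_eq_zero_of_differentiableAt hh
  have h1 : fderiv ℝ (fun z => φ z • h z) w = _ := fderiv_fun_smul hφ (hh.restrictScalars ℝ)
  unfold dbar at h0 ⊢
  have h2 : fderiv ℝ h w 1 + I • fderiv ℝ h w I = 0 := by
    exact (smul_eq_zero.mp h0).resolve_left (by norm_num)
  rw [h1]
  have h3 : (2 : ℂ)⁻¹ • (φ w • (fderiv ℝ h w 1 + I • fderiv ℝ h w I)) = 0 := by simp [h2]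
  rw [← sub_eq_zero, ← h3]
  simp only [add_apply, smul_apply,
    ContinuousLinearMap.smulRight_apply, smul_eq_mul]
  module

/-- Functions which are continuous in polar coordinates and vanish for large radii are integrable
over the domain of polar coordinates. -/
theorem integrableOn_polar {F : Type*} [NormedAddCommGroup F] {G : ℝ × ℝ → F}
    (hG : Continuous G) {R : ℝ} (hR : ∀ p : ℝ × ℝ, R < p.1 → G p = 0) : IntegrableOn G (Ioi 0 ×ˢ Ioo (-π) π) := by
  have h1 : IntegrableOn G (Icc 0 R ×ˢ Icc (-π) π) :=
    hG.continuousOn.integrableOn_compact (isCompact_Icc.prod isCompact_Icc)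
  refine h1.of_forall_sdiff_eq_zero (measurableSet_Ioi.prod measurableSet_Ioo) fun p hp => ?_
  refine hR p (not_le.mp fun h => hp.2 ⟨⟨hp.1.1.le, h⟩, hp.1.2.1.le, hp.1.2.2.le⟩)

/-- Up to the factor `r`, the integrand is the derivative in `θ` of `u` along a circle, and that
function has period `2π`. -/
theorem integral_circle_fderiv_eq_zero [CompleteSpace E] {u : ℂ → E} (hu : ContDiff ℝ 1 u) (z : ℂ)
    {r : ℝ} (hr : r ≠ 0) :
    ∫ θ in Ioo (-π) π, fderiv ℝ u (z + r * exp (θ * I)) (I * exp (θ * I)) = 0 := by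
  have hd : ∀ θ : ℝ, HasDerivAt (fun θ : ℝ => u (z + r * exp (θ * I)))
      (r • fderiv ℝ u (z + r * exp (θ * I)) (I * exp (θ * I))) θ := by
    intro θ
    have h1 : HasDerivAt (fun θ : ℝ => z + r * exp (θ * I)) (r • (I * exp (θ * I))) θ := by
      have h2 : HasDerivAt (fun θ : ℝ => (θ : ℂ) * I) (1 * I) θ :=
        (ofRealCLM.hasDerivAt (x := θ)).mul_const I
      have h3 := (h2.cexp.const_mul (r : ℂ)).const_add z
      refine h3.congr_deriv ?_
      rw [real_smul]; ring
    have h4 := (hu.differentiable one_ne_zero (z + r * exp (θ * I))).hasFDerivAt.comp_hasDerivAt θ h1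
    rw [ContinuousLinearMap.map_smul] at h4
    exact h4
  have hc : Continuous fun θ : ℝ => fderiv ℝ u (z + r * exp (θ * I)) (I * exp (θ * I)) := by
    have h := hu.continuous_fderiv one_ne_zero
    fun_prop
  have h5 := intervalIntegral.integral_eq_sub_of_hasDerivAt (a := -π) (b := π)
    (fun θ _ => hd θ) ((hc.const_smul r).intervalIntegrable _ _)
  rw [intervalIntegral.integral_smul, intervalIntegral.integral_of_le (by linarith [Real.pi_pos]),
    integral_Ioc_eq_integral_Ioo] at h5
  have h6 : exp (((-π : ℝ) : ℂ) * I) = exp ((π : ℝ) * I) := by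
    rw [exp_pi_mul_I]; push_cast; rw [neg_mul, exp_neg, exp_pi_mul_I]; norm_num
  rw [h6, sub_self] at h5
  exact (smul_eq_zero.mp h5).resolve_left hr

/-- The fundamental theorem of calculus along a ray: compact support removes the contribution from
infinity. -/
theorem integral_ray_fderiv [CompleteSpace E] {u : ℂ → E} (hu : ContDiff ℝ 1 u)
    (hs : HasCompactSupport u) (z : ℂ) {v : ℂ} (hv : ‖v‖ = 1) :
    ∫ r in Ioi (0 : ℝ), fderiv ℝ u (z + r * v) v = -u z := by
  have hcl : ContDiff ℝ 1 fun r : ℝ => u (z + r * v) := by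
    refine hu.comp (contDiff_const.add ((ofRealCLM.contDiff).mul contDiff_const))
  have he : Topology.IsClosedEmbedding fun r : ℝ => z + r * v := by
    have : Isometry fun r : ℝ => z + r * v := by
      refine Isometry.of_dist_eq fun a b => ?_
      rw [dist_add_left, dist_eq, ← sub_mul, norm_mul, hv, mul_one, ← ofReal_sub, norm_real]; rfl
    exact this.isClosedEmbedding
  have h1 := HasCompactSupport.integral_Ioi_deriv_eq hcl (hs.comp_isClosedEmbedding he) 0
  have h2 : ∀ r : ℝ, deriv (fun r : ℝ => u (z + r * v)) r = fderiv ℝ u (z + r * v) v := by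
    intro r
    have h3 : HasDerivAt (fun r : ℝ => z + (r : ℂ) * v) v r := by
      simpa using ((ofRealCLM.hasDerivAt (x := r)).mul_const v).const_add z
    exact ((hu.differentiable one_ne_zero (z + r * v)).hasFDerivAt.comp_hasDerivAt r h3).deriv
  simpa [h2] using h1

/-- The Cauchy–Pompeiu formula for compactly supported functions. -/
theorem integral_inv_smul_dbar [CompleteSpace E] {u : ℂ → E} (hu : ContDiff ℝ 1 u)
    (hs : HasCompactSupport u) (z : ℂ) : ∫ w, (w - z)⁻¹ • dbar u w = -(π : ℂ) • u z := by
  have hfd := hu.continuous_fderiv one_ne_zero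
  obtain ⟨R, hR⟩ : ∃ R : ℝ, ∀ r θ : ℝ, R < r → fderiv ℝ u (z + r * exp (θ * I)) = 0 := by
    obtain ⟨R, hR⟩ := (hs.fderiv ℝ).isCompact.isBounded.subset_closedBall z
    refine ⟨R, fun r θ hr => by_contra fun h => ?_⟩
    have := hR (subset_tsupport _ h)
    rw [mem_closedBall_iff_norm] at this
    simp only [add_sub_cancel_left, norm_mul, norm_exp_ofReal_mul_I, mul_one, norm_real] at this
    exact absurd ((le_abs_self r).trans this) (not_le.mpr hr)
  have hexp : ∀ p : ℝ × ℝ, Complex.polarCoord.symm p = p.1 * exp (p.2 * I) := by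
    intro p; rw [Complex.polarCoord_symm_apply, exp_mul_I]; push_cast; rfl
  rw [← integral_add_right_eq_self _ z, ← Complex.integral_comp_polarCoord_symm]
  set A : ℝ × ℝ → E := fun p => fderiv ℝ u (z + p.1 * exp (p.2 * I)) (exp (p.2 * I)) with hA
  set B : ℝ × ℝ → E := fun p => fderiv ℝ u (z + p.1 * exp (p.2 * I)) (I * exp (p.2 * I)) with hB
  have hAc : Continuous A := by simp only [hA]; fun_prop
  have hBc : Continuous B := by simp only [hB]; fun_prop
  have hAi : IntegrableOn A (Ioi 0 ×ˢ Ioo (-π) π) :=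
    integrableOn_polar hAc (R := R) fun p hp => by simp [hA, hR _ _ hp]
  have hBi : IntegrableOn B (Ioi 0 ×ˢ Ioo (-π) π) :=
    integrableOn_polar hBc (R := R) fun p hp => by simp [hB, hR _ _ hp]
  -- The Jacobian cancels the modulus of the Cauchy kernel, and `e^{-iθ} ∂̄u` is half the radial
  -- derivative `A` plus `i/2` times `B`, the angular derivative divided by the radius. Integration
  -- over circles kills `B`; integration over rays turns `A` into `-u z`.
  have hpt : ∀ p ∈ Ioi (0 : ℝ) ×ˢ Ioo (-π) π,
      p.1 • ((Complex.polarCoord.symm p + z - z)⁻¹ • dbar u (Complex.polarCoord.symm p + z)) =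
        (2 : ℂ)⁻¹ • (A p + I • B p) := by
    intro p hp
    have hp0 : (p.1 : ℂ) ≠ 0 := ofReal_ne_zero.mpr (ne_of_gt hp.1)
    set v := exp (p.2 * I) with hv
    have hv0 : v ≠ 0 := exp_ne_zero _
    have hvn : v = v.re • (1 : ℂ) + v.im • I := by
      apply Complex.ext <;> simp
    have hIv : I * v = v.re • I - v.im • (1 : ℂ) := by
      apply Complex.ext <;> simp
    have hcs : v⁻¹ = v.re - v.im * I := by
      have h1 : v.re = Real.cos p.2 := exp_ofReal_mul_I_re _
      have h2 : v.im = Real.sin p.2 := exp_ofReal_mul_I_im _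
      rw [h1, h2, hv, ← exp_neg, ← neg_mul, exp_mul_I, cos_neg, sin_neg]
      push_cast; ring
    rw [hexp, ← hv, add_sub_cancel_right, add_comm _ z, ← Complex.coe_smul, smul_smul, mul_inv,
      ← mul_assoc, mul_inv_cancel₀ hp0, one_mul]
    simp only [hA, hB, ← hv, dbar]
    generalize fderiv ℝ u (z + p.1 * v) = D
    have hD1 : D v = (v.re : ℂ) • D 1 + (v.im : ℂ) • D I := by
      conv_lhs => rw [hvn]
      rw [map_add, map_smul, map_smul, Complex.coe_smul, Complex.coe_smul]
    have hD2 : D (I * v) = (v.re : ℂ) • D I - (v.im : ℂ) • D 1 := by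
      rw [hIv, map_sub, map_smul, map_smul, Complex.coe_smul, Complex.coe_smul]
    rw [hD1, hD2, hcs]
    -- As formal expressions in `I` the two sides differ by this multiple of `I * I + 1`.
    have h0 : (-(2 : ℂ)⁻¹ * v.im * (I * I + 1)) • D I = 0 := by rw [I_mul_I]; simp
    rw [← sub_eq_zero, ← h0]
    module
  have hst : polarCoord.target = Ioi (0 : ℝ) ×ˢ Ioo (-π) π := rfl
  rw [hst, setIntegral_congr_fun (measurableSet_Ioi.prod measurableSet_Ioo) hpt]
  rw [integral_smul, integral_add hAi (g := fun p => I • B p) (hBi.smul I), integral_smul]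
  have hB0 : ∫ p in Ioi (0 : ℝ) ×ˢ Ioo (-π) π, B p = 0 := by
    rw [Measure.volume_eq_prod, setIntegral_prod _ (by rwa [← Measure.volume_eq_prod])]
    refine setIntegral_eq_zero_of_forall_eq_zero fun r hr => ?_
    exact integral_circle_fderiv_eq_zero hu z (ne_of_gt hr)
  have hA0 : ∫ p in Ioi (0 : ℝ) ×ˢ Ioo (-π) π, A p = -((2 * π : ℝ) • u z) := by
    rw [Measure.volume_eq_prod, ← setIntegral_prod_swap,
      setIntegral_prod _ (by
        rw [← Measure.volume_eq_prod]
        exact IntegrableOn.swap hAi)]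
    have h1 : ∀ θ ∈ Ioo (-π) π, ∫ r in Ioi (0 : ℝ), A (Prod.swap (θ, r)) = -u z := fun θ _ =>
      integral_ray_fderiv hu hs z (norm_exp_ofReal_mul_I θ)
    rw [setIntegral_congr_fun measurableSet_Ioo h1, setIntegral_const]
    simp [two_mul, Real.pi_pos.le]
  rw [hA0, hB0, smul_zero, add_zero, ← Complex.coe_smul]
  push_cast
  module

end Pompeiu

/-! ### Cutoffs: contour integrals and their products as area integrals -/

section Cutoff

variable {E : Type*} [NormedAddCommGroup E] [NormedSpace ℂ E]

/-- `φ` is a continuously differentiable function with compact support in `Ω` and equal to `1` near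
`K`. -/
structure IsCutoff (K Ω : Set ℂ) (φ : ℂ → ℂ) : Prop where
  contDiff : ContDiff ℝ 1 φ
  hasCompactSupport : HasCompactSupport φ
  tsupport_subset : tsupport φ ⊆ Ω
  eventually_eq_one : ∀ z ∈ K, φ =ᶠ[𝓝 z] 1

theorem exists_isCutoff {K Ω : Set ℂ} (hK : IsCompact K) (hΩ : IsOpen Ω) (h : K ⊆ Ω) :
    ∃ φ, IsCutoff K Ω φ := by
  obtain ⟨K', hK', hKK', hK'Ω⟩ := exists_compact_between hK hΩ h
  obtain ⟨f, hf1, hf0, -⟩ := exists_contMDiffMap_one_nhds_of_subset_interior (n := 1)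
    (modelWithCornersSelf ℝ ℂ) hK.isClosed hKK'
  have hts : tsupport (fun z => (f z : ℂ)) ⊆ K' := by
    refine closure_minimal (fun z hz => by_contra fun h => hz ?_) hK'.isClosed
    simp [hf0 z h]
  refine ⟨fun z => (f z : ℂ), ofRealCLM.contDiff.comp f.contMDiff.contDiff,
    hK'.of_isClosed_subset (isClosed_tsupport _) hts, hts.trans hK'Ω, fun z hz => ?_⟩
  filter_upwards [hf1.filter_mono (nhds_le_nhdsSet hz)] with w hw
  simp [hw]

theorem IsCutoff.subset_tsupport {K Ω : Set ℂ} {φ : ℂ → ℂ} (h : IsCutoff K Ω φ) :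
    K ⊆ tsupport φ := fun z hz => subset_closure <| by
  rw [Function.mem_support, (h.eventually_eq_one z hz).self_of_nhds]
  exact one_ne_zero

theorem IsCutoff.mono {K K' Ω Ω' : Set ℂ} {φ : ℂ → ℂ} (h : IsCutoff K Ω φ) (hK : K' ⊆ K)
    (hΩ : Ω ⊆ Ω') : IsCutoff K' Ω' φ :=
  ⟨h.contDiff, h.hasCompactSupport, h.tsupport_subset.trans hΩ,
    fun z hz => h.eventually_eq_one z (hK hz)⟩

theorem IsCutoff.notMem_tsupport_dbar {K Ω : Set ℂ} {φ : ℂ → ℂ} (h : IsCutoff K Ω φ) {z : ℂ}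
    (hz : z ∈ K) : z ∉ tsupport (dbar φ) := by
  rw [notMem_tsupport_iff_eventuallyEq]
  filter_upwards [(h.eventually_eq_one z hz).eventuallyEq_nhds] with w hw
  rw [hw.dbar_eq]
  exact dbar_eq_zero_of_differentiableAt (differentiableAt_const (1 : ℂ))

/-- Near a point outside `D` the scalar factor is identically zero, so the values of `H` there,
which may be junk, do not matter. The same dichotomy gives the smooth versions below. -/
theorem continuous_smul_of_tsupport_subset {a : ℂ → ℂ} {H : ℂ → E} {D : Set ℂ} (hD : IsOpen D)
    (ha : Continuous a) (hH : ContinuousOn H D) (hs : tsupport a ⊆ D) :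
    Continuous fun z => a z • H z := by
  rw [continuous_iff_continuousAt]
  intro z
  by_cases hz : z ∈ D
  · exact ha.continuousAt.smul (hH.continuousAt (hD.mem_nhds hz))
  · have h0 : a =ᶠ[𝓝 z] 0 := notMem_tsupport_iff_eventuallyEq.mp fun h => hz (hs h)
    refine (continuousAt_const (y := (0 : E))).congr ?_
    filter_upwards [h0] with w hw
    simp [hw]

theorem integrable_smul_of_tsupport_subset {a : ℂ → ℂ} {H : ℂ → E} {D : Set ℂ} (hD : IsOpen D)
    (ha : Continuous a) (hH : ContinuousOn H D) (hs : tsupport a ⊆ D) (hc : HasCompactSupport a) :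
    Integrable fun z => a z • H z :=
  (continuous_smul_of_tsupport_subset hD ha hH hs).integrable_of_hasCompactSupport
    (hc.smul_right (f' := H))

theorem contDiff_smul_of_tsupport_subset [CompleteSpace E] {χ : ℂ → ℂ} {h : ℂ → E} {D : Set ℂ}
    (hD : IsOpen D) (hχ : ContDiff ℝ 1 χ) (hh : DifferentiableOn ℂ h D) (hs : tsupport χ ⊆ D) :
    ContDiff ℝ 1 fun z => χ z • h z := by
  rw [contDiff_iff_contDiffAt]
  intro z
  by_cases hz : z ∈ D
  · exact hχ.contDiffAt.smul
      (((hh.contDiffOn hD).contDiffAt (hD.mem_nhds hz)).restrict_scalars ℝ)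
  · have h0 : χ =ᶠ[𝓝 z] 0 := notMem_tsupport_iff_eventuallyEq.mp fun h => hz (hs h)
    refine (contDiffAt_const (c := (0 : E))).congr_of_eventuallyEq ?_
    filter_upwards [h0] with w hw
    simp [hw]

theorem dbar_smul_of_tsupport_subset {χ : ℂ → ℂ} {h : ℂ → E} {D : Set ℂ}
    (hD : IsOpen D) (hχ : ContDiff ℝ 1 χ) (hh : DifferentiableOn ℂ h D) (hs : tsupport χ ⊆ D)
    (z : ℂ) : dbar (fun z => χ z • h z) z = dbar χ z • h z := by
  by_cases hz : z ∈ D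
  · exact dbar_smul (hχ.differentiable one_ne_zero z) (hh.differentiableAt (hD.mem_nhds hz))
  · have h0 : χ =ᶠ[𝓝 z] 0 := notMem_tsupport_iff_eventuallyEq.mp fun h => hz (hs h)
    have h1 : (fun z => χ z • h z) =ᶠ[𝓝 z] fun _ => 0 := by
      filter_upwards [h0] with w hw
      simp [hw]
    rw [h1.dbar_eq, h0.dbar_eq]
    rw [dbar_eq_zero_of_differentiableAt (differentiableAt_const (0 : E)),
      dbar_eq_zero_of_differentiableAt (u := 0) (differentiableAt_const (0 : ℂ)), zero_smul]

/-- Fubini's theorem for the Cauchy kernel, away from its singularity. -/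
theorem integral_cauchyKernel_swap [CompleteSpace E] {X : Type*} [MeasurableSpace X] {μ : Measure X} [SFinite μ]
    {γ δ : X → ℂ} (hγ : AEMeasurable γ μ) (hδ : Integrable δ μ) {v : ℂ → E} (hv : Continuous v)
    (hvs : HasCompactSupport v) {K : Set ℂ} (hK : IsCompact K) (hKv : Disjoint K (tsupport v))
    (hγK : ∀ᵐ t ∂μ, δ t ≠ 0 → γ t ∈ K) :
    Integrable (fun w => (∫ t, δ t / (γ t - w) ∂μ) • v w) ∧
      ∫ t, δ t • (∫ w, (γ t - w)⁻¹ • v w) ∂μ = ∫ w, (∫ t, δ t / (γ t - w) ∂μ) • v w := by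
  -- The Cauchy kernel is bounded on a product of two disjoint compact sets, so the double integrand
  -- is dominated by `C ‖δ‖ ‖v‖`.
  obtain ⟨C, hC⟩ : ∃ C, ∀ p ∈ K ×ˢ tsupport v, ‖(p.1 - p.2)⁻¹‖ ≤ C := by
    refine (hK.prod hvs.isCompact).exists_bound_of_continuousOn ?_
    refine (continuousOn_fst.sub continuousOn_snd).inv₀ fun p hp h => ?_
    exact hKv.le_bot ⟨hp.1, (sub_eq_zero.mp h) ▸ hp.2⟩
  have hm : AEStronglyMeasurable (fun p : X × ℂ => (δ p.1 / (γ p.1 - p.2)) • v p.2)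
      (μ.prod volume) := by
    have h1 : AEMeasurable (fun p : X × ℂ => γ p.1) (μ.prod volume) := hγ.comp_fst
    have h2 : AEMeasurable (fun p : X × ℂ => δ p.1) (μ.prod volume) :=
      hδ.aestronglyMeasurable.aemeasurable.comp_fst
    have h3 : AEMeasurable (fun p : X × ℂ => p.2) (μ.prod volume) := measurable_snd.aemeasurable
    exact (h2.div (h1.sub h3)).aestronglyMeasurable.smul
      (hv.aestronglyMeasurable.comp_snd)
  have hi : Integrable (fun p : X × ℂ => (δ p.1 / (γ p.1 - p.2)) • v p.2) (μ.prod volume) := by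
    have hb := (hδ.norm.mul_prod (hv.integrable_of_hasCompactSupport (μ := volume) hvs).norm).const_mul C
    refine hb.mono' hm ?_
    have hae : ∀ᵐ p ∂(μ.prod (volume : Measure ℂ)), δ p.1 ≠ 0 → γ p.1 ∈ K :=
      Measure.quasiMeasurePreserving_fst.ae hγK
    filter_upwards [hae] with p hp
    by_cases h1 : δ p.1 = 0
    · simp [h1]
    by_cases h2 : p.2 ∈ tsupport v
    · have := hC (γ p.1, p.2) ⟨hp h1, h2⟩
      rw [norm_smul, div_eq_mul_inv, norm_mul]
      calc ‖δ p.1‖ * ‖(γ p.1 - p.2)⁻¹‖ * ‖v p.2‖ ≤ ‖δ p.1‖ * C * ‖v p.2‖ := by gcongr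
        _ = _ := by ring
    · simp [image_eq_zero_of_notMem_tsupport h2]
  have hsm : ∀ w, ∫ t, (δ t / (γ t - w)) • v w ∂μ = (∫ t, δ t / (γ t - w) ∂μ) • v w := by
    intro w
    by_cases h2 : w ∈ tsupport v
    · exact integral_smul_const _ _
    · simp [image_eq_zero_of_notMem_tsupport h2]
  constructor
  · simpa only [hsm] using hi.integral_prod_right
  · have := integral_integral_swap (f := fun t w => (δ t / (γ t - w)) • v w) hi
    simp only [hsm] at this
    rw [← this]
    refine integral_congr_ae (Eventually.of_forall fun t => ?_)
    simp only [← integral_smul, smul_smul, div_eq_mul_inv]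

/-- The integral of a function which is holomorphic on `W \ σ` along a cycle that winds once around
the points of `Ω` and not at all around those outside the closure of `Ω`, as an area integral that
does not depend on the cycle. -/
theorem cycle_integral_eq [CompleteSpace E] {Ω W σ : Set ℂ} {m : ℕ} {γ δ : Fin m → ℝ → ℂ}
    (hγ : ∀ k, ContinuousOn (γ k) (Icc 0 1)) (hδ : ∀ k, IntervalIntegrable (δ k) volume 0 1)
    (hfr : ∀ k, ∀ t ∈ Icc (0 : ℝ) 1, γ k t ∈ frontier Ω) (hΩ : IsOpen Ω)
    (hΩb : Bornology.IsBounded Ω) (hW : IsOpen W) (hΩW : closure Ω ⊆ W)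
    (hin : ∀ w ∈ Ω, ∑ k, ∫ t in (0 : ℝ)..1, δ k t / (γ k t - w) = 2 * π * I)
    (hout : ∀ w ∉ closure Ω, ∑ k, ∫ t in (0 : ℝ)..1, δ k t / (γ k t - w) = 0)
    (hσ : IsClosed σ) {h : ℂ → E} (hh : DifferentiableOn ℂ h (W \ σ)) {φ : ℂ → ℂ}
    (hφ : IsCutoff σ Ω φ) :
    ∑ k, ∫ t in (0 : ℝ)..1, δ k t • h (γ k t) = -(2 * I) • ∫ w, dbar φ w • h w := by
  have hσΩ : σ ⊆ Ω := hφ.subset_tsupport.trans hφ.tsupport_subset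
  have hcl : IsCompact (closure Ω) := hΩb.isCompact_closure
  obtain ⟨ψ, hψ⟩ := exists_isCutoff hcl hW hΩW
  have hD : IsOpen (W \ σ) := hW.sdiff hσ
  -- The factor `1 - φ` cuts out the singular set `σ` and `ψ` gives compact support. On the cycle `χ
  -- = 1`, so Cauchy–Pompeiu for `χ h` represents `h` there by an area integral over `∂̄χ`.
  set χ : ℂ → ℂ := fun z => ψ z * (1 - φ z) with hχ
  have hχc : ContDiff ℝ 1 χ := hψ.contDiff.mul (contDiff_const.sub hφ.contDiff)
  have hχψ : tsupport χ ⊆ tsupport ψ := tsupport_mul_subset_left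
  have hχD : tsupport χ ⊆ W \ σ := by
    refine fun z hz => ⟨hψ.tsupport_subset (hχψ hz), fun hzσ => ?_⟩
    refine notMem_tsupport_iff_eventuallyEq.mpr ?_ hz
    filter_upwards [hφ.eventually_eq_one z hzσ] with w hw
    simp [hχ, hw]
  have hχs : HasCompactSupport χ := hψ.hasCompactSupport.of_isClosed_subset (isClosed_tsupport _) hχψ
  set u : ℂ → E := fun z => χ z • h z with hu
  have huc : ContDiff ℝ 1 u := contDiff_smul_of_tsupport_subset hD hχc hh hχD
  have hus : HasCompactSupport u := hχs.smul_right (f' := h)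
  have hdu : ∀ w, dbar u w = dbar χ w • h w := dbar_smul_of_tsupport_subset hD hχc hh hχD
  -- near the closure of `Ω`, the cutoff is `1 - φ`
  have hχ1 : ∀ z ∈ closure Ω, χ =ᶠ[𝓝 z] fun z => 1 - φ z := by
    intro z hz
    filter_upwards [hψ.eventually_eq_one z hz] with w hw
    simp [hχ, hw]
  have hfrφ : ∀ z ∈ frontier Ω, φ =ᶠ[𝓝 z] 0 := fun z hz =>
    notMem_tsupport_iff_eventuallyEq.mp fun h1 =>
      (hΩ.frontier_eq ▸ hz).2 (hφ.tsupport_subset h1)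
  have hfr1 : ∀ z ∈ frontier Ω, χ =ᶠ[𝓝 z] 1 := by
    intro z hz
    filter_upwards [hχ1 z (frontier_subset_closure hz), hfrφ z hz] with w h1 h2
    simp [h1, h2]
  have hfrd : ∀ z ∈ frontier Ω, z ∉ tsupport (dbar u) := by
    intro z hz
    rw [notMem_tsupport_iff_eventuallyEq]
    filter_upwards [(hfr1 z hz).eventuallyEq_nhds] with w hw
    rw [hdu, hw.dbar_eq, dbar_eq_zero_of_differentiableAt (u := 1) (differentiableAt_const (1 : ℂ))]
    simp
  have hdχ : ∀ z ∈ Ω, dbar χ z = -dbar φ z := by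
    intro z hz
    rw [(hχ1 z (subset_closure hz)).dbar_eq]
    have : fderiv ℝ (fun z => 1 - φ z) z = -fderiv ℝ φ z := fderiv_const_sub 1
    simp only [dbar, this, neg_apply]
    module
  have hpomp : ∀ z ∈ frontier Ω, h z = (π : ℂ)⁻¹ • ∫ w, (z - w)⁻¹ • dbar u w := by
    intro z hz
    have h1 := integral_inv_smul_dbar huc hus z
    have h2 : u z = h z := by simp [hu, (hfr1 z hz).self_of_nhds]
    have h3 : ∫ w, (z - w)⁻¹ • dbar u w = -∫ w, (w - z)⁻¹ • dbar u w := by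
      rw [← integral_neg]
      congr 1
      ext w
      rw [← neg_smul, ← inv_neg, neg_sub]
    rw [h3, h1, h2, neg_smul, neg_neg, smul_smul,
      inv_mul_cancel₀ (ofReal_ne_zero.mpr Real.pi_ne_zero), one_smul]
  have hswap : ∀ k, Integrable (fun w => (∫ t in (0 : ℝ)..1, δ k t / (γ k t - w)) • dbar u w) ∧
      ∫ t in (0 : ℝ)..1, δ k t • h (γ k t) =
        (π : ℂ)⁻¹ • ∫ w, (∫ t in (0 : ℝ)..1, δ k t / (γ k t - w)) • dbar u w := by
    intro k
    have hsub : Ioc (0 : ℝ) 1 ⊆ Icc 0 1 := Ioc_subset_Icc_self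
    have hmem : ∀ᵐ t ∂(volume.restrict (Ioc (0 : ℝ) 1)), δ k t ≠ 0 → γ k t ∈ γ k '' Icc 0 1 := by
      filter_upwards [ae_restrict_mem measurableSet_Ioc] with t ht _
      exact mem_image_of_mem _ (hsub ht)
    have := integral_cauchyKernel_swap (μ := volume.restrict (Ioc (0 : ℝ) 1)) (γ := γ k)
      (((hγ k).mono hsub).aemeasurable measurableSet_Ioc)
      ((intervalIntegrable_iff_integrableOn_Ioc_of_le zero_le_one).mp (hδ k))
      (continuous_dbar huc) (hasCompactSupport_dbar hus) (isCompact_Icc.image_of_continuousOn (hγ k))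
      (disjoint_left.mpr (by
        rintro _ ⟨t, ht, rfl⟩
        exact hfrd _ (hfr k t ht))) hmem
    simp only [intervalIntegral.integral_of_le (zero_le_one' ℝ)]
    refine ⟨this.1, ?_⟩
    rw [← this.2, ← integral_smul]
    refine setIntegral_congr_fun measurableSet_Ioc fun t ht => ?_
    rw [hpomp _ (hfr k t (hsub ht)), smul_comm]
  rw [Finset.sum_congr rfl fun k _ => (hswap k).2, ← Finset.smul_sum,
    ← integral_finsetSum _ fun k _ => (hswap k).1, ← integral_smul, ← integral_smul]
  congr 1
  ext w
  -- After Fubini the weight at `w` is the winding integral of the cycle: `2πi` on `Ω`, where `∂̄χ =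
  -- -∂̄φ`, and `0` outside the closure. On the frontier nothing is known of the weight, but `∂̄u`
  -- vanishes there.
  rw [← Finset.sum_smul]
  by_cases hw : w ∈ Ω
  · rw [hin w hw, hdu, hdχ w hw, neg_smul, smul_neg, smul_neg, smul_smul, neg_smul]
    congr 2
    field_simp
  have hφ0 : dbar φ w = 0 := by
    by_contra h1
    exact hw (hφ.tsupport_subset (tsupport_dbar_subset φ (subset_closure h1)))
  rw [hφ0, zero_smul, smul_zero]
  by_cases hw' : w ∈ closure Ω
  · have : w ∈ frontier Ω := hΩ.frontier_eq ▸ ⟨hw', hw⟩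
    rw [image_eq_zero_of_notMem_tsupport (hfrd w this), smul_zero, smul_zero]
  · rw [hout w hw', zero_smul, smul_zero]

/-- The product of two area integrals with kernels that satisfy a resolvent equation. -/
theorem sum_cutoff_integral_mul {𝒜 : Type*} [NormedRing 𝒜] [NormedAlgebra ℂ 𝒜] [CompleteSpace 𝒜]
    {ι : Type*} [Fintype ι] {H K : ι → ℂ → 𝒜} {L : ℂ → 𝒜} {σ Ωf Ωg : Set ℂ} (hσ : IsClosed σ)
    (hH : ∀ i, ContinuousOn (H i) σᶜ) (hK : ∀ i, ContinuousOn (K i) σᶜ) (hL : ContinuousOn L σᶜ)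
    (hres : ∀ z ∉ σ, ∀ w ∉ σ, (z - w) • ∑ i, H i z * K i w = L w - L z)
    (hΩf : IsOpen Ωf) (hΩg : IsOpen Ωg) {f g : ℂ → ℂ}
    (hf : DifferentiableOn ℂ f Ωf) (hg : DifferentiableOn ℂ g Ωg) {φ ψ : ℂ → ℂ}
    (hψ : IsCutoff σ Ωg ψ) (hφ : IsCutoff (tsupport ψ) Ωf φ) :
    ∑ i, (∫ z, dbar φ z • f z • H i z) * (∫ w, dbar ψ w • g w • K i w) =
      -(π : ℂ) • ∫ w, dbar ψ w • (f w * g w) • L w := by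
  set a : ℂ → ℂ := dbar fun z => φ z • f z with ha
  set b : ℂ → ℂ := dbar fun z => ψ z • g z with hb
  have hfC := contDiff_smul_of_tsupport_subset hΩf hφ.contDiff hf hφ.tsupport_subset
  have hgC := contDiff_smul_of_tsupport_subset hΩg hψ.contDiff hg hψ.tsupport_subset
  have hfs : HasCompactSupport fun z => φ z • f z := hφ.hasCompactSupport.smul_right (f' := f)
  have hgs : HasCompactSupport fun z => ψ z • g z := hψ.hasCompactSupport.smul_right (f' := g)
  have hae : ∀ z, a z = dbar φ z * f z :=
    dbar_smul_of_tsupport_subset hΩf hφ.contDiff hf hφ.tsupport_subset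
  have hbe : ∀ z, b z = dbar ψ z * g z :=
    dbar_smul_of_tsupport_subset hΩg hψ.contDiff hg hψ.tsupport_subset
  have hac : Continuous a := continuous_dbar hfC
  have hbc : Continuous b := continuous_dbar hgC
  have has : HasCompactSupport a := hasCompactSupport_dbar hfs
  have hbs : HasCompactSupport b := hasCompactSupport_dbar hgs
  have hta : tsupport a ⊆ tsupport (dbar φ) := by
    rw [show a = fun z => dbar φ z * f z from funext hae]
    exact tsupport_mul_subset_left
  have htb : tsupport b ⊆ tsupport (dbar ψ) := by
    rw [show b = fun z => dbar ψ z * g z from funext hbe]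
    exact tsupport_mul_subset_left
  -- As `φ` is constant near the support of `ψ`, the densities `a` and `b` have disjoint supports;
  -- this keeps `(z - w)⁻¹` away from its singularity in the double integral.
  have haψ : ∀ z ∈ tsupport a, z ∉ tsupport ψ := fun z hz h =>
    hφ.notMem_tsupport_dbar h (hta hz)
  have hbψ : tsupport b ⊆ tsupport ψ := htb.trans (tsupport_dbar_subset ψ)
  have haσ : tsupport a ⊆ σᶜ := fun z hz h => haψ z hz (hψ.subset_tsupport h)
  have hbσ : tsupport b ⊆ σᶜ := fun z hz h => hψ.notMem_tsupport_dbar h (htb hz)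
  have hHi : ∀ i, Integrable fun z => a z • H i z := fun i =>
    integrable_smul_of_tsupport_subset hσ.isOpen_compl hac (hH i) haσ has
  have hKi : ∀ i, Integrable fun z => b z • K i z := fun i =>
    integrable_smul_of_tsupport_subset hσ.isOpen_compl hbc (hK i) hbσ hbs
  have hLc : Continuous fun z => b z • L z :=
    continuous_smul_of_tsupport_subset hσ.isOpen_compl hbc hL hbσ
  have hLs : HasCompactSupport fun z => b z • L z := hbs.smul_right (f' := L)
  have hker : ∀ z : ℂ, ContinuousOn (fun w => (z - w)⁻¹) {z}ᶜ := fun z =>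
    (continuousOn_const.sub continuousOn_id).inv₀ fun w hw h => hw (sub_eq_zero.mp h).symm
  -- The resolvent equation replaces the sum by `(z - w)⁻¹ (L w - L z)`. The coefficient of `L z` is
  -- the Cauchy–Pompeiu integral of `ψ g` at a point where `ψ` is zero.
  have hinner : ∀ z, ∑ i, (a z • H i z) * (∫ w, b w • K i w) =
      a z • ∫ w, (z - w)⁻¹ • b w • L w := by
    intro z
    by_cases hz : a z = 0
    · simp [hz]
    have hzt : z ∈ tsupport a := subset_tsupport _ hz
    have hbz : tsupport b ⊆ {z}ᶜ := fun w hw h => haψ z hzt (hbψ ((mem_singleton_iff.mp h) ▸ hw))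
    have h1 : ∀ i, (a z • H i z) * (∫ w, b w • K i w) =
        a z • ∫ w, H i z * (b w • K i w) := fun i => by
      rw [integral_const_mul_of_integrable (hKi i), smul_mul_assoc]
    simp only [h1]
    rw [← Finset.smul_sum, ← integral_finsetSum _ fun i _ => (hKi i).const_mul _]
    congr 1
    have h2 : ∀ w, ∑ i, H i z * (b w • K i w) =
        (z - w)⁻¹ • b w • L w - ((b w * (z - w)⁻¹) • L z) := by
      intro w
      by_cases hw : b w = 0
      · simp [hw]
      have hwt : w ∈ tsupport b := subset_tsupport _ hw
      have hzw : z - w ≠ 0 := sub_ne_zero.mpr fun h => hbz hwt h.symm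
      have h3 := hres z (haσ hzt) w (hbσ hwt)
      have h4 : ∑ i, H i z * K i w = (z - w)⁻¹ • (L w - L z) := by
        rw [← h3, smul_smul, inv_mul_cancel₀ hzw, one_smul]
      simp only [mul_smul_comm]
      rw [← Finset.smul_sum, h4]
      module
    have hk1 : Integrable fun w => (z - w)⁻¹ • b w • L w := by
      simp only [fun w => smul_comm (z - w)⁻¹ (b w) (L w)]
      exact integrable_smul_of_tsupport_subset (hσ.isOpen_compl.inter isOpen_compl_singleton) hbc
        (((hker z).mono inter_subset_right).smul (hL.mono inter_subset_left))
        (subset_inter hbσ hbz) hbs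
    have hk2 : Integrable fun w => b w * (z - w)⁻¹ :=
      integrable_smul_of_tsupport_subset isOpen_compl_singleton hbc (hker z) hbz hbs
    have h5 : ∫ w, b w * (z - w)⁻¹ = 0 := by
      have h6 := integral_inv_smul_dbar hgC hgs z
      rw [image_eq_zero_of_notMem_tsupport (haψ z hzt), zero_smul, smul_zero] at h6
      rw [← neg_eq_zero, ← integral_neg, ← h6]
      congr 1
      ext w
      rw [← hb, smul_eq_mul, mul_comm, ← neg_mul, ← inv_neg, neg_sub]
    simp only [h2]
    rw [integral_sub hk1 (hk2.smul_const (L z)),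
      integral_smul_const, h5, zero_smul, sub_zero]
  have hswap := (integral_cauchyKernel_swap (μ := volume) (γ := id) (δ := a) aemeasurable_id
    (hac.integrable_of_hasCompactSupport has) hLc hLs has.isCompact
    (disjoint_left.mpr fun z hz h => haψ z hz (hbψ (tsupport_smul_subset_left b L h)))
    (Eventually.of_forall fun z hz => subset_tsupport _ hz)).2
  have h7 : ∀ z, dbar φ z • f z = a z := fun z => (hae z).symm
  have h8 : ∀ z, dbar ψ z • g z = b z := fun z => (hbe z).symm
  have hleft : ∑ i, (∫ z, dbar φ z • f z • H i z) * (∫ w, dbar ψ w • g w • K i w) =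
      ∫ z, a z • ∫ w, (z - w)⁻¹ • b w • L w := by
    simp only [← smul_assoc, h7, h8]
    simp only [smul_assoc, ← hinner]
    rw [integral_finsetSum _ fun i _ => (hHi i).mul_const _]
    exact Finset.sum_congr rfl fun i _ => (integral_mul_const_of_integrable (hHi i)).symm
  rw [hleft]
  simp only [id] at hswap
  rw [hswap, ← integral_smul]
  congr 1
  ext w
  by_cases hw : b w = 0
  · have h0 : dbar ψ w * g w = 0 := by rw [← hbe, hw]
    have h0' : dbar ψ w * (f w * g w) = 0 := by linear_combination f w * h0
    rw [hw, zero_smul, smul_zero, smul_smul (dbar ψ w), h0', zero_smul, smul_zero]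
  have hwt : w ∈ tsupport b := subset_tsupport _ hw
  -- With the order of integration exchanged, the `z`-integral is the Cauchy–Pompeiu integral of `φ
  -- f` at a point where `φ = 1`.
  have h9 := integral_inv_smul_dbar hfC hfs w
  rw [(hφ.eventually_eq_one w (hbψ hwt)).self_of_nhds, Pi.one_apply, one_smul] at h9
  have h10 : ∫ z, a z / (z - w) = -(π : ℂ) • f w := by
    rw [← h9]
    congr 1
    ext z
    rw [← ha, smul_eq_mul, div_eq_mul_inv, mul_comm]
  rw [h10, hbe]
  simp only [smul_smul, smul_eq_mul]
  congr 1
  ring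

end Cutoff

universe u

/-! ### The Clifford algebra and its complex representation -/

section CliffordAlgebra

variable {𝔄 : Type*} [NormedRing 𝔄]

theorem Cliff.mono_add (A : Finset (Fin 5)) (a b : 𝔄) :
    Cliff.mono A (a + b) = Cliff.mono A a + Cliff.mono A b :=
  Pi.single_add (f := fun _ : Finset (Fin 5) => 𝔄) A a b

theorem Cliff.mono_zero (A : Finset (Fin 5)) : Cliff.mono A (0 : 𝔄) = 0 :=
  Pi.single_zero (M := fun _ : Finset (Fin 5) => 𝔄) A

theorem Cliff.mono_neg (A : Finset (Fin 5)) (a : 𝔄) : Cliff.mono A (-a) = -Cliff.mono A a :=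
  Pi.single_neg (f := fun _ : Finset (Fin 5) => 𝔄) A a

theorem Cliff.mono_sum {ι : Type*} (s : Finset ι) (A : Finset (Fin 5)) (a : ι → 𝔄) :
    Cliff.mono A (∑ i ∈ s, a i) = ∑ i ∈ s, Cliff.mono A (a i) := by
  classical
  induction s using Finset.induction_on with
  | empty => simp [Cliff.mono_zero]
  | insert i s hi ih => rw [Finset.sum_insert hi, Finset.sum_insert hi, Cliff.mono_add, ih]

theorem Cliff.mono_apply_self (A : Finset (Fin 5)) (a : 𝔄) : Cliff.mono A a A = a :=
  Pi.single_eq_same (M := fun _ : Finset (Fin 5) => 𝔄) A a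

theorem Cliff.mono_apply_of_ne {A B : Finset (Fin 5)} (h : B ≠ A) (a : 𝔄) :
    Cliff.mono A a B = 0 :=
  Pi.single_eq_of_ne (M := fun _ : Finset (Fin 5) => 𝔄) h a

theorem Cliff.sum_mono (a : Cliff 𝔄) : ∑ A, Cliff.mono A (a A) = a :=
  Finset.univ_sum_single (M := fun _ : Finset (Fin 5) => 𝔄) a

theorem Cliff.mono_mul_mono (A B : Finset (Fin 5)) (a b : 𝔄) :
    Cliff.mono A a * Cliff.mono B b = Cliff.mono (symmDiff A B) (cliffSign A B • (a * b)) := by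
  funext C
  rw [cliff_mul_apply, Finset.sum_eq_single A]
  · rw [Cliff.mono_apply_self]
    by_cases hC : C = symmDiff A B
    · subst hC
      rw [symmDiff_symmDiff_cancel_left, Cliff.mono_apply_self, Cliff.mono_apply_self]
    · rw [Cliff.mono_apply_of_ne hC, Cliff.mono_apply_of_ne, mul_zero, smul_zero]
      rintro rfl
      exact hC (symmDiff_symmDiff_cancel_left A C).symm
  · intro A' _ hA'
    rw [Cliff.mono_apply_of_ne hA', zero_mul, smul_zero]
  · simp

theorem Cliff.mono_empty_mul_mono (A : Finset (Fin 5)) (a b : 𝔄) :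
    Cliff.mono ∅ a * Cliff.mono A b = Cliff.mono A (a * b) := by
  rw [Cliff.mono_mul_mono, ← Finset.bot_eq_empty, bot_symmDiff]
  simp [cliffSign]

theorem Cliff.mono_mul_mono_empty (A : Finset (Fin 5)) (a b : 𝔄) :
    Cliff.mono A a * Cliff.mono ∅ b = Cliff.mono A (a * b) := by
  rw [Cliff.mono_mul_mono, ← Finset.bot_eq_empty, symmDiff_bot]
  simp [cliffSign]

theorem Cliff.commute_mono_empty {c : 𝔄} {a : Cliff 𝔄} (h : ∀ A, Commute c (a A)) :
    Commute (Cliff.mono ∅ c) a := by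
  rw [← Cliff.sum_mono a]
  refine Commute.sum_right _ _ _ fun A _ => ?_
  rw [commute_iff_eq, Cliff.mono_empty_mul_mono, Cliff.mono_mul_mono_empty, (h A).eq]

theorem Cliff.mono_one_mul_self (i : Fin 5) (a b : 𝔄) :
    Cliff.mono {i} a * Cliff.mono {i} b = -Cliff.mono ∅ (a * b) := by
  rw [Cliff.mono_mul_mono, symmDiff_self, Finset.bot_eq_empty]
  simp [cliffSign, Cliff.mono_neg]

theorem Cliff.mono_one_mul_anticomm {i j : Fin 5} (hij : i ≠ j) {a b : 𝔄} (h : Commute a b) :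
    Cliff.mono {i} a * Cliff.mono {j} b = -(Cliff.mono {j} b * Cliff.mono {i} a) := by
  rw [Cliff.mono_mul_mono, Cliff.mono_mul_mono, symmDiff_comm ({j} : Finset (Fin 5)), ← Cliff.mono_neg, h.eq]
  rcases lt_or_gt_of_ne hij with h1 | h1
  · simp [cliffSign, h1.le, not_le.mpr h1]
  · simp [cliffSign, h1.le, not_le.mpr h1]

/-- The square of a vector with commuting components is scalar. -/
theorem sum_mono_mul_self (x : Fin 5 → 𝔄) (hx : ∀ i j, Commute (x i) (x j)) :
    (∑ j, Cliff.mono {j} (x j)) * ∑ j, Cliff.mono {j} (x j) = -Cliff.mono ∅ (∑ j, x j * x j) := by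
  have hsub : ∀ k : Finset (Fin 5), (∑ j ∈ k, Cliff.mono {j} (x j)) * ∑ j ∈ k, Cliff.mono {j} (x j)
      = -∑ j ∈ k, Cliff.mono ∅ (x j * x j) := by
    intro k
    induction k using Finset.induction_on with
    | empty => simp
    | insert i s hi ih =>
      rw [Finset.sum_insert hi, Finset.sum_insert hi, add_mul, mul_add, mul_add, ih,
        Cliff.mono_one_mul_self]
      have h1 : Cliff.mono {i} (x i) * ∑ j ∈ s, Cliff.mono {j} (x j) =
          -((∑ j ∈ s, Cliff.mono {j} (x j)) * Cliff.mono {i} (x i)) := by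
        rw [Finset.mul_sum, Finset.sum_mul, ← Finset.sum_neg_distrib]
        exact Finset.sum_congr rfl fun j hj =>
          Cliff.mono_one_mul_anticomm (ne_of_mem_of_not_mem hj hi).symm (hx i j)
      rw [h1]
      abel
  rw [hsub, ← Cliff.mono_sum]

/-- A difference of squares: the scalar part commutes with the vector part, whose square is minus
the sum of the squares of its components. Having only an `e_∅` coefficient, `T T̄` commutes with the
units `e_A`. -/
theorem paravector_mul_conj (x : Fin 6 → 𝔄) (hx : ∀ i j, Commute (x i) (x j)) :
    paravector x * paravectorConj x = Cliff.mono ∅ (∑ i, x i * x i) := by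
  have h1 : Commute (Cliff.mono ∅ (x 0)) (∑ j : Fin 5, Cliff.mono {j} (x j.succ)) := by
    refine Commute.sum_right _ _ _ fun j _ => ?_
    rw [commute_iff_eq, Cliff.mono_empty_mul_mono, Cliff.mono_mul_mono_empty, (hx 0 _).eq]
  have h2 := sum_mono_mul_self (fun j => x j.succ) fun i j => hx _ _
  rw [paravector, paravectorConj, ← h1.mul_self_sub_mul_self_eq, h2, Cliff.mono_empty_mul_mono,
    sub_neg_eq_add, ← Cliff.mono_add, Fin.sum_univ_succ (fun i => x i * x i)]

theorem paravector_add_conj (x : Fin 6 → 𝔄) :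
    paravector x + paravectorConj x = Cliff.mono ∅ (x 0 + x 0) := by
  rw [paravector, paravectorConj, Cliff.mono_add]
  abel

theorem commute_paravectorConj_apply {x : Fin 6 → 𝔄} {c : 𝔄} (hc : ∀ i, Commute c (x i))
    (A : Finset (Fin 5)) : Commute c (paravectorConj x A) := by
  have hm : ∀ (B : Finset (Fin 5)) (i : Fin 6), Commute c (Cliff.mono B (x i) A) := by
    intro B i
    by_cases h : A = B
    · subst h; rw [Cliff.mono_apply_self]; exact hc i
    · rw [Cliff.mono_apply_of_ne h]; exact Commute.zero_right c
  have hs : (∑ j : Fin 5, Cliff.mono {j} (x j.succ)) A = ∑ j : Fin 5, Cliff.mono {j} (x j.succ) A :=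
    Finset.sum_apply (M := fun _ : Finset (Fin 5) => 𝔄) _ _ _
  have he : paravectorConj x A =
      Cliff.mono ∅ (x 0) A - (∑ j : Fin 5, Cliff.mono {j} (x j.succ)) A := rfl
  rw [he, hs]
  exact (hm _ _).sub_right (Commute.sum_right _ _ _ fun j _ => hm _ _)

theorem toCliff_mul_self {J : R6} (hJ : J ∈ imagSphere) : J.toCliff * J.toCliff = -1 := by
  have h1 := paravector_mul_conj (fun i => J i) fun i j => mul_comm _ _
  have h2 : paravectorConj (fun i => J i) = -J.toCliff := by
    rw [R6.toCliff, paravector, paravectorConj, hJ.1, Cliff.mono_zero]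
    abel
  have h3 : ∑ i, J i * J i = 1 := by
    have h4 := EuclideanSpace.real_norm_sq_eq J
    rw [hJ.2] at h4
    simpa [sq] using h4.symm
  rw [h2, h3, mul_neg] at h1
  rw [← neg_eq_iff_eq_neg]
  exact h1

theorem toCliff_slicePoint {J : R6} (hJ : J ∈ imagSphere) (z : ℂ) :
    (slicePoint J z).toCliff = Cliff.mono ∅ z.re + J.toCliff * Cliff.mono ∅ z.im := by
  have h0 : (slicePoint J z) 0 = z.re := by simp [slicePoint, hJ.1]
  have h1 : ∀ j : Fin 5, (slicePoint J z) j.succ = J j.succ * z.im := by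
    intro j; simp [slicePoint, mul_comm]
  simp only [R6.toCliff, paravector, h0, h1, hJ.1, Cliff.mono_zero, zero_add, Finset.sum_mul,
    Cliff.mono_mul_mono_empty]

section ToOp

variable (V : Type*) [NormedAddCommGroup V] [NormedSpace ℝ V]

theorem Cliff.toOp_mono (A : Finset (Fin 5)) (r : ℝ) :
    (Cliff.mono A r).toOp V = Cliff.mono A (r • (1 : V →L[ℝ] V)) := by
  funext B
  by_cases h : B = A
  · subst h
    rw [Cliff.mono_apply_self, Cliff.toOp, Cliff.mono_apply_self]; rfl
  · rw [Cliff.mono_apply_of_ne h, Cliff.toOp, Cliff.mono_apply_of_ne h, zero_smul]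

theorem Cliff.toOp_mul (a b : Cliff ℝ) : (a * b).toOp V = a.toOp V * b.toOp V := by
  funext C
  rw [cliff_mul_apply, Cliff.toOp, cliff_mul_apply, Finset.sum_smul]
  refine Finset.sum_congr rfl fun A _ => ?_
  have h : ∀ r s : ℝ, (r * s) • ContinuousLinearMap.id ℝ V =
      (r • ContinuousLinearMap.id ℝ V) * (s • ContinuousLinearMap.id ℝ V) := fun r s => by
    ext v
    simp [mul_smul, smul_comm r s]
  rw [smul_assoc, h]
  rfl

theorem Cliff.toOp_add (a b : Cliff ℝ) : (a + b).toOp V = a.toOp V + b.toOp V := by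
  funext C
  exact add_smul _ _ _

theorem Cliff.toOp_neg (a : Cliff ℝ) : (-a).toOp V = -a.toOp V := by
  funext C
  exact neg_smul _ _

theorem Cliff.toOp_sum {ι : Type*} (s : Finset ι) (a : ι → Cliff ℝ) :
    (∑ i ∈ s, a i).toOp V = ∑ i ∈ s, (a i).toOp V := by
  classical
  induction s using Finset.induction_on with
  | empty => funext C; exact zero_smul _ _
  | insert i s hi ih => rw [Finset.sum_insert hi, Finset.sum_insert hi, Cliff.toOp_add, ih]

theorem Cliff.toOp_one : (1 : Cliff ℝ).toOp V = 1 := by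
  refine (Cliff.toOp_mono V ∅ 1).trans ?_
  rw [one_smul]; rfl

theorem Cliff.commute_toOp_apply (a : Cliff ℝ) (c : V →L[ℝ] V) (A : Finset (Fin 5)) :
    Commute c (a.toOp V A) := by
  rw [Cliff.toOp]
  exact (Commute.one_right c).smul_right _

end ToOp

/-- Each coefficient of the product is a sum of `2⁵ = 32` terms, one for each subset of the
generators. The bound makes right multiplication a bounded operator for the sup norm. -/
theorem cliff_norm_mul_le (a b : Cliff 𝔄) : ‖a * b‖ ≤ 32 * ‖a‖ * ‖b‖ := by
  have hle : ∀ (c : Cliff 𝔄) A, ‖c A‖ ≤ ‖c‖ := fun c A =>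
    norm_le_pi_norm (G := fun _ : Finset (Fin 5) => 𝔄) c A
  refine (pi_norm_le_iff_of_nonneg (G := fun _ : Finset (Fin 5) => 𝔄) (by positivity)).mpr fun C => ?_
  have hsign : ∀ A B : Finset (Fin 5), |cliffSign A B| = 1 := fun A B => by
    simp only [cliffSign, Finset.abs_prod]
    exact Finset.prod_eq_one fun i _ => Finset.prod_eq_one fun j _ => by split_ifs <;> simp
  rw [cliff_mul_apply]
  calc _ ≤ ∑ A : Finset (Fin 5), ‖cliffSign A (symmDiff A C) • (a A * b (symmDiff A C))‖ :=
        norm_sum_le _ _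
    _ ≤ ∑ _A : Finset (Fin 5), ‖a‖ * ‖b‖ := by
        refine Finset.sum_le_sum fun A _ => ?_
        have h1 : ‖cliffSign A (symmDiff A C) • (a A * b (symmDiff A C))‖ =
            ‖a A * b (symmDiff A C)‖ := by
          rcases (abs_eq zero_le_one).mp (hsign A (symmDiff A C)) with h | h <;> simp [h]
        rw [h1]
        exact (norm_mul_le _ _).trans (mul_le_mul (hle _ _) (hle _ _) (norm_nonneg _) (norm_nonneg _))
    _ = _ := by simp; ring

theorem cliff_smul_mul [NormedAlgebra ℝ 𝔄] (r : ℝ) (a b : Cliff 𝔄) :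
    (r • a) * b = r • (a * b) := by
  funext C
  change (r • a * b) C = r • (a * b) C
  rw [cliff_mul_apply, cliff_mul_apply, Finset.smul_sum]
  refine Finset.sum_congr rfl fun A _ => ?_
  rw [show (r • a) A = r • a A from rfl, smul_mul_assoc, smul_comm]

theorem cliff_mul_smul [NormedAlgebra ℝ 𝔄] (r : ℝ) (a b : Cliff 𝔄) :
    a * (r • b) = r • (a * b) := by
  funext C
  change (a * r • b) C = r • (a * b) C
  rw [cliff_mul_apply, cliff_mul_apply, Finset.smul_sum]
  refine Finset.sum_congr rfl fun A _ => ?_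
  rw [show (r • b) (symmDiff A C) = r • b (symmDiff A C) from rfl, mul_smul_comm, smul_comm]

theorem Cliff.mono_empty_smul_one [NormedAlgebra ℝ 𝔄] (r : ℝ) :
    Cliff.mono ∅ (r • (1 : 𝔄)) = r • (1 : Cliff 𝔄) := by
  funext A
  change _ = r • (1 : Cliff 𝔄) A
  by_cases hA : A = ∅
  · subst hA
    rw [Cliff.mono_apply_self, cliff_one_empty]
  · rw [Cliff.mono_apply_of_ne hA, cliff_one_ne hA, smul_zero]

theorem Cliff.mono_empty_mul (r : ℝ) (x : Cliff ℝ) : Cliff.mono ∅ r * x = r • x := by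
  have h := Cliff.mono_empty_smul_one (𝔄 := ℝ) r
  rw [smul_eq_mul, mul_one] at h
  rw [h, cliff_smul_mul, one_mul]

/-- Right multiplication, as a bounded operator. -/
noncomputable def cliffMulRight [NormedAlgebra ℝ 𝔄] (a : Cliff 𝔄) : Cliff 𝔄 →L[ℝ] Cliff 𝔄 :=
  LinearMap.mkContinuous
    { toFun := fun x => x * a
      map_add' := fun x y => add_mul x y a
      map_smul' := fun r x => cliff_smul_mul r x a } (32 * ‖a‖)
    fun x => (cliff_norm_mul_le x a).trans_eq (by ring)

theorem norm_cliffMulRight_le [NormedAlgebra ℝ 𝔄] (a : Cliff 𝔄) :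
    ‖cliffMulRight a‖ ≤ 32 * ‖a‖ :=
  LinearMap.mkContinuous_norm_le _ (by positivity) _

/-- The action of `a` on the complexified dual of the Clifford algebra. -/
noncomputable def cliffDualAct [NormedAlgebra ℝ 𝔄] (a : Cliff 𝔄) :
    (Cliff 𝔄 →L[ℝ] ℂ) →L[ℂ] (Cliff 𝔄 →L[ℝ] ℂ) :=
  LinearMap.mkContinuous
    { toFun := fun φ => φ.comp (cliffMulRight a)
      map_add' := fun φ ψ => ContinuousLinearMap.add_comp φ ψ _
      map_smul' := fun c φ => ContinuousLinearMap.smul_comp c φ _ } (32 * ‖a‖)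
    fun φ => (φ.opNorm_comp_le _).trans (by
      rw [mul_comm]
      exact mul_le_mul_of_nonneg_right (norm_cliffMulRight_le a) (norm_nonneg _))

theorem cliffDualAct_apply [NormedAlgebra ℝ 𝔄] (a : Cliff 𝔄) (φ : Cliff 𝔄 →L[ℝ] ℂ) (x : Cliff 𝔄) :
    cliffDualAct a φ x = φ (x * a) := rfl

theorem norm_cliffDualAct_le [NormedAlgebra ℝ 𝔄] (a : Cliff 𝔄) :
    ‖cliffDualAct a‖ ≤ 32 * ‖a‖ :=
  LinearMap.mkContinuous_norm_le _ (by positivity) _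

/-- The algebra `𝔄 ⊗ ℝ₅` embeds into a complex Banach algebra. -/
theorem exists_complex_representation {𝔄 : Type u} [NormedRing 𝔄] [NormedAlgebra ℝ 𝔄] :
    ∃ (𝒜 : Type u) (_ : NormedRing 𝒜) (_ : NormedAlgebra ℂ 𝒜) (_ : CompleteSpace 𝒜)
      (ρ : Cliff 𝔄 →L[ℝ] 𝒜), ρ 1 = 1 ∧ (∀ a b, ρ (a * b) = ρ a * ρ b) ∧
        ∃ K, AntilipschitzWith K ρ := by
  -- Right multiplication reverses products and precomposition reverses them again, so the action on
  -- real-linear maps into `ℂ` is multiplicative. The target `ℂ` supplies both complex scalars and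
  -- completeness.
  refine ⟨(Cliff 𝔄 →L[ℝ] ℂ) →L[ℂ] (Cliff 𝔄 →L[ℝ] ℂ), inferInstance, inferInstance, inferInstance,
    LinearMap.mkContinuous
    { toFun := cliffDualAct
      map_add' := fun a b => ?_
      map_smul' := fun r a => ?_ } 32 norm_cliffDualAct_le, ?_, ?_, ?_⟩
  · ext φ x
    simp [cliffDualAct_apply, mul_add]
  · ext φ x
    rw [cliffDualAct_apply, cliff_mul_smul, φ.map_smul]
    rfl
  · ext φ x
    change cliffDualAct 1 φ x = φ x
    rw [cliffDualAct_apply, mul_one]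
  · intro a b
    ext φ x
    change cliffDualAct (a * b) φ x = cliffDualAct a (cliffDualAct b φ) x
    rw [cliffDualAct_apply, cliffDualAct_apply, cliffDualAct_apply, mul_assoc]
  · refine ⟨‖(1 : Cliff 𝔄)‖₊, ContinuousLinearMap.antilipschitz_of_bound _ fun a => ?_⟩
    -- A Hahn–Banach functional that norms `a`, tested at `1`, gives `‖a‖ ≤ ‖1‖ ‖ρ a‖`.
    obtain ⟨g, hg, hga⟩ := exists_dual_vector'' ℝ a
    set φ : Cliff 𝔄 →L[ℝ] ℂ := ofRealCLM.comp g with hφ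
    have h1 : ‖φ‖ ≤ 1 := (ofRealCLM.opNorm_comp_le g).trans (by simpa using hg)
    have h2 : cliffDualAct a φ 1 = (‖a‖ : ℂ) := by
      rw [cliffDualAct_apply, one_mul, hφ]
      simp [hga]
    calc ‖a‖ = ‖cliffDualAct a φ 1‖ := by rw [h2]; simp
      _ ≤ ‖cliffDualAct a φ‖ * ‖(1 : Cliff 𝔄)‖ := ContinuousLinearMap.le_opNorm _ _
      _ ≤ (‖cliffDualAct a‖ * 1) * ‖(1 : Cliff 𝔄)‖ := by
        gcongr
        exact ((cliffDualAct a).le_opNorm φ).trans (by gcongr)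
      _ = _ := by rw [mul_one, mul_comm]; rfl

end CliffordAlgebra

/-! ### Splitting along an imaginary unit -/

section Idempotents

variable {𝒜 : Type*} [Ring 𝒜] [Algebra ℂ 𝒜]

/-- The idempotent onto the part where the imaginary unit `j` acts as `i`. -/
noncomputable def idemPos (j : 𝒜) : 𝒜 := (2 : ℂ)⁻¹ • (1 - I • j)

/-- The idempotent onto the part where the imaginary unit `j` acts as `-i`. -/
noncomputable def idemNeg (j : 𝒜) : 𝒜 := (2 : ℂ)⁻¹ • (1 + I • j)

theorem idemPos_add_idemNeg (j : 𝒜) : idemPos j + idemNeg j = 1 := by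
  unfold idemPos idemNeg
  module

theorem mul_idemPos {j : 𝒜} (hj : j * j = -1) : j * idemPos j = I • idemPos j := by
  have h : (I * I) • j = -j := by rw [I_mul_I, neg_smul, one_smul]
  simp only [idemPos, mul_smul_comm, mul_sub, mul_one, hj, smul_comm I (2 : ℂ)⁻¹, smul_sub (I : ℂ),
    smul_smul I I, h]
  module

theorem mul_idemNeg {j : 𝒜} (hj : j * j = -1) : j * idemNeg j = -I • idemNeg j := by
  have h : (I * I) • j = -j := by rw [I_mul_I, neg_smul, one_smul]
  simp only [idemNeg, mul_smul_comm, mul_add, mul_one, hj, smul_comm (-I) (2 : ℂ)⁻¹,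
    smul_add (-I : ℂ), smul_smul (-I) I, neg_mul, neg_smul, h]
  module

theorem Commute.idemPos_right {j x : 𝒜} (h : Commute x j) : Commute x (idemPos j) :=
  ((Commute.one_right x).sub_right (h.smul_right I)).smul_right _

theorem Commute.idemNeg_right {j x : 𝒜} (h : Commute x j) : Commute x (idemNeg j) :=
  ((Commute.one_right x).add_right (h.smul_right I)).smul_right _

theorem idemPos_mul_self {j : 𝒜} (hj : j * j = -1) : idemPos j * idemPos j = idemPos j := by
  conv_lhs => enter [1]; rw [idemPos]
  rw [smul_mul_assoc, sub_mul, smul_mul_assoc, mul_idemPos hj, smul_smul, I_mul_I, one_mul]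
  module

theorem idemNeg_mul_self {j : 𝒜} (hj : j * j = -1) : idemNeg j * idemNeg j = idemNeg j := by
  conv_lhs => enter [1]; rw [idemNeg]
  rw [smul_mul_assoc, add_mul, smul_mul_assoc, mul_idemNeg hj, smul_smul, mul_neg, I_mul_I, one_mul]
  module

theorem idemPos_mul_idemNeg {j : 𝒜} (hj : j * j = -1) : idemPos j * idemNeg j = 0 := by
  conv_lhs => enter [1]; rw [idemPos]
  rw [smul_mul_assoc, sub_mul, smul_mul_assoc, mul_idemNeg hj, smul_smul, mul_neg, I_mul_I, one_mul]
  module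

theorem idemNeg_mul_idemPos {j : 𝒜} (hj : j * j = -1) : idemNeg j * idemPos j = 0 := by
  conv_lhs => enter [1]; rw [idemNeg]
  rw [smul_mul_assoc, add_mul, smul_mul_assoc, mul_idemPos hj, smul_smul, I_mul_I, one_mul]
  module

/-- The element that is `x` where `j` acts as `i` and `x'` where `j` acts as `-i` (on the right). -/
noncomputable def splitRight (j x x' : 𝒜) : 𝒜 := x * idemPos j + x' * idemNeg j

/-- The element that is `x` where `j` acts as `i` and `x'` where `j` acts as `-i` (on the left). -/
noncomputable def splitLeft (j x x' : 𝒜) : 𝒜 := idemPos j * x + idemNeg j * x'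

theorem splitRight_self (j x : 𝒜) : splitRight j x x = x := by
  rw [splitRight, ← mul_add, idemPos_add_idemNeg, mul_one]

theorem splitLeft_self (j x : 𝒜) : splitLeft j x x = x := by
  rw [splitLeft, ← add_mul, idemPos_add_idemNeg, one_mul]

theorem splitRight_eq_splitLeft {j x x' : 𝒜} (hx : Commute x j) (hx' : Commute x' j) :
    splitRight j x x' = splitLeft j x x' := by
  rw [splitRight, splitLeft, hx.idemPos_right.eq, hx'.idemNeg_right.eq]

/-- The idempotents are orthogonal, so mixed terms vanish once they are moved past `u` and `u'`.
Only the right factor has to commute with `j`; this matters because `T̄` does not commute with `J`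
in general. -/
theorem splitRight_mul {j x x' u u' : 𝒜} (hj : j * j = -1) (hu : Commute u j) (hu' : Commute u' j) :
    splitRight j x x' * splitRight j u u' = splitRight j (x * u) (x' * u') := by
  rw [splitRight_eq_splitLeft hu hu', splitRight, splitLeft, splitRight, add_mul, mul_add, mul_add,
    mul_assoc x, mul_assoc x, mul_assoc x', mul_assoc x', ← mul_assoc (idemPos j),
    ← mul_assoc (idemPos j), ← mul_assoc (idemNeg j), ← mul_assoc (idemNeg j), idemPos_mul_self hj,
    idemNeg_mul_self hj, idemPos_mul_idemNeg hj, idemNeg_mul_idemPos hj, mul_assoc x, mul_assoc x',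
    hu.idemPos_right.eq, hu'.idemNeg_right.eq]
  simp

theorem splitLeft_mul {j x x' u u' : 𝒜} (hj : j * j = -1) (hu : Commute u j) (hu' : Commute u' j) :
    splitLeft j u u' * splitLeft j x x' = splitLeft j (u * x) (u' * x') := by
  rw [← splitRight_eq_splitLeft hu hu', splitRight, splitLeft, splitLeft, add_mul, mul_add, mul_add,
    mul_assoc u, mul_assoc u, mul_assoc u', mul_assoc u', ← mul_assoc (idemPos j),
    ← mul_assoc (idemPos j), ← mul_assoc (idemNeg j), ← mul_assoc (idemNeg j), idemPos_mul_self hj,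
    idemNeg_mul_self hj, idemPos_mul_idemNeg hj, idemNeg_mul_idemPos hj, ← mul_assoc u,
    ← mul_assoc u' (idemNeg j) x', hu.idemPos_right.eq, hu'.idemNeg_right.eq, mul_assoc, mul_assoc]
  simp

theorem splitRight_sub (j x x' u u' : 𝒜) :
    splitRight j x x' - splitRight j u u' = splitRight j (x - u) (x' - u') := by
  simp only [splitRight, sub_mul]; abel

theorem splitRight_add (j x x' u u' : 𝒜) :
    splitRight j x x' + splitRight j u u' = splitRight j (x + u) (x' + u') := by
  simp only [splitRight, add_mul]; abel

theorem smul_splitRight (j x x' : 𝒜) (c : ℂ) :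
    c • splitRight j x x' = splitRight j (c • x) (c • x') := by
  simp only [splitRight, smul_add, smul_mul_assoc]

theorem smul_splitLeft (j x x' : 𝒜) (c : ℂ) :
    c • splitLeft j x x' = splitLeft j (c • x) (c • x') := by
  simp only [splitLeft, smul_add, mul_smul_comm]

theorem splitLeft_sub (j x x' u u' : 𝒜) :
    splitLeft j x x' - splitLeft j u u' = splitLeft j (x - u) (x' - u') := by
  simp only [splitLeft, mul_sub]; abel

theorem commute_smul_one (c : ℂ) (x : 𝒜) : Commute (c • (1 : 𝒜)) x :=
  (Commute.one_left x).smul_left c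

/-- On the two parts `j` acts as `i` and as `-i`. Applied to points this yields `z` and `z̄`,
applied to `α + J β` the values `α ± i β`. -/
theorem splitRight_complex (j : 𝒜) (r s : ℝ) :
    (r : ℂ) • (1 : 𝒜) + (s : ℂ) • j =
      splitRight j ((r + s * I : ℂ) • 1) ((r - s * I : ℂ) • 1) := by
  have h : (s * (I * I + 1) : ℂ) • j = 0 := by rw [I_mul_I]; simp
  simp only [splitRight, smul_mul_assoc, one_mul, idemPos, idemNeg]
  rw [← sub_eq_zero, ← h]
  module

/-- This is how `ds_J = ds (-J)` turns into `-i dz` on one part and `i dz̄` on the other. -/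
theorem splitRight_smul_one_mul_neg {j : 𝒜} (hj : j * j = -1) (c c' : ℂ) :
    splitRight j (c • 1) (c' • 1) * -j = splitRight j ((-I * c) • 1) ((I * c') • 1) := by
  have h1 : idemPos j * j = I • idemPos j := by
    rw [← mul_idemPos hj, (Commute.refl j).idemPos_right.eq]
  have h2 : idemNeg j * j = -I • idemNeg j := by
    rw [← mul_idemNeg hj, (Commute.refl j).idemNeg_right.eq]
  simp only [splitRight, smul_mul_assoc, one_mul, add_mul, mul_neg, h1, h2]
  module

end Idempotents

/-! ### The resolvent equation -/

section Kernels

variable {𝒜 : Type*} [NormedRing 𝒜] [NormedAlgebra ℂ 𝒜]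

/-- The quadratic polynomial `z² - z a + b`. -/
noncomputable def quadPencil (a b : 𝒜) (z : ℂ) : 𝒜 := (z ^ 2) • 1 - z • a + b

/-- The points at which `z² - z a + b` is not invertible. -/
def quadSpectrum (a b : 𝒜) : Set ℂ := {z | ¬ IsUnit (quadPencil a b z)}

/-- The complex counterparts of the resolvent operators. -/
noncomputable def FineOp.kernel (P : FineOp) (a b y : 𝒜) (z : ℂ) : 𝒜 :=
  match P with
  | .id => (z • 1 - y) * Ring.inverse (quadPencil a b z)
  | .D => (-4 : ℂ) • Ring.inverse (quadPencil a b z)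
  | .Δ => (-8 : ℂ) • ((z • 1 - y) * Ring.inverse (quadPencil a b z) ^ 2)
  | .ΔD => (16 : ℂ) • Ring.inverse (quadPencil a b z) ^ 2
  | .ΔΔ => (64 : ℂ) • ((z • 1 - y) * Ring.inverse (quadPencil a b z) ^ 3)

theorem differentiable_quadPencil (a b : 𝒜) : Differentiable ℂ (quadPencil a b) := by
  unfold quadPencil
  fun_prop

theorem isClosed_quadSpectrum [CompleteSpace 𝒜] (a b : 𝒜) : IsClosed (quadSpectrum a b) :=
  (Units.isOpen.preimage (differentiable_quadPencil a b).continuous).isClosed_compl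

theorem differentiableOn_inverse_quadPencil [CompleteSpace 𝒜] (a b : 𝒜) :
    DifferentiableOn ℂ (fun z => Ring.inverse (quadPencil a b z)) (quadSpectrum a b)ᶜ := by
  intro z hz
  obtain ⟨x, hx⟩ := not_not.mp hz
  have h := differentiableAt_inverse (𝕜 := ℂ) x.isUnit
  rw [hx] at h
  exact (h.comp z (differentiable_quadPencil a b z)).differentiableWithinAt

theorem FineOp.differentiableOn_kernel [CompleteSpace 𝒜] (P : FineOp) (a b y : 𝒜) :
    DifferentiableOn ℂ (P.kernel a b y) (quadSpectrum a b)ᶜ := by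
  have h := differentiableOn_inverse_quadPencil a b
  have h1 : DifferentiableOn ℂ (fun z : ℂ => z • (1 : 𝒜) - y) (quadSpectrum a b)ᶜ := by fun_prop
  cases P
  · exact h1.mul h
  · exact h.const_smul (-4 : ℂ)
  · exact (h1.mul (h.pow 2)).const_smul (-8 : ℂ)
  · exact (h.pow 2).const_smul (16 : ℂ)
  · exact (h1.mul (h.pow 3)).const_smul (64 : ℂ)

theorem Commute.inverse_left {R : Type*} [Ring R] {x u : R} (h : Commute x u) : Commute (Ring.inverse x) u := by
  by_cases hx : IsUnit x
  · obtain ⟨v, rfl⟩ := hx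
    rw [Ring.inverse_unit]
    exact h.units_inv_left
  · rw [Ring.inverse_non_unit _ hx]
    exact Commute.zero_left u

theorem Commute.quadPencil_left {a b x : 𝒜} (ha : Commute a x) (hb : Commute b x) (z : ℂ) :
    Commute (quadPencil a b z) x :=
  (((Commute.one_left x).smul_left _).sub_left (ha.smul_left z)).add_left hb

theorem Commute.inverse_quadPencil_left {a b x : 𝒜} (ha : Commute a x) (hb : Commute b x) (z : ℂ) :
    Commute (Ring.inverse (quadPencil a b z)) x :=
  (ha.quadPencil_left hb z).inverse_left

/-- From `z² - z a + b = (z - y) (z - a + y)` one gets `(z - w) (z - y) (w - y) p r = (w - y) r - (z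
- y) p`. Multiplied by `p² + p r + r²`, the right side telescopes up to `(w - z) (p² r + p r²)`,
which the last two summands cancel. -/
theorem resolvent_equation_comm {R : Type*} [CommRing R] {z w a b y p r : R}
    (hp : p * (z ^ 2 - z * a + b) = 1) (hr : r * (w ^ 2 - w * a + b) = 1)
    (hy : y * y = a * y - b) :
    (z - w) * ((z - y) * p ^ 3 * ((w - y) * r) + (z - y) * p * ((w - y) * r ^ 3)
      + (z - y) * p ^ 2 * ((w - y) * r ^ 2) + p ^ 2 * r + p * r ^ 2) =
      (w - y) * r ^ 3 - (z - y) * p ^ 3 := by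
  linear_combination (z - w) * (p ^ 3 * r + p ^ 2 * r ^ 2 + p * r ^ 3) * hy
    + (w - y) * (p ^ 2 * r + p * r ^ 2 + r ^ 3) * hp
    - (z - y) * (p ^ 3 + p ^ 2 * r + p * r ^ 2) * hr

/-- The identity takes place in the subalgebra generated by the pairwise commuting `a`, `y`, `p`,
`r`, where the commutative version applies; `b = a y - y²` belongs to it. -/
theorem resolvent_equation {a b y p r : 𝒜} {z w : ℂ} (hay : Commute a y)
    (hp : p * quadPencil a b z = 1) (hr : r * quadPencil a b w = 1)
    (hap : Commute a p) (hyp : Commute y p) (har : Commute a r) (hyr : Commute y r)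
    (hpr : Commute p r) (hy : y * y = a * y - b) :
    (z - w) • ((z • 1 - y) * p ^ 3 * ((w • 1 - y) * r) + (z • 1 - y) * p * ((w • 1 - y) * r ^ 3)
      + (z • 1 - y) * p ^ 2 * ((w • 1 - y) * r ^ 2) + p ^ 2 * r + p * r ^ 2) =
      (w • 1 - y) * r ^ 3 - (z • 1 - y) * p ^ 3 := by
  let s : Set 𝒜 := {a, y, p, r}
  have hs : ∀ x ∈ s, ∀ x' ∈ s, x * x' = x' * x := by
    rintro x (rfl | rfl | rfl | rfl) x' (rfl | rfl | rfl | rfl) <;>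
      first
        | rfl
        | exact hay.eq
        | exact hay.symm.eq
        | exact hap.eq
        | exact hap.symm.eq
        | exact har.eq
        | exact har.symm.eq
        | exact hyp.eq
        | exact hyp.symm.eq
        | exact hyr.eq
        | exact hyr.symm.eq
        | exact hpr.eq
        | exact hpr.symm.eq
  have hc := Algebra.isMulCommutative_adjoin ℂ hs
  let _ : CommRing (Algebra.adjoin ℂ s) :=
    { (inferInstance : Ring (Algebra.adjoin ℂ s)) with mul_comm := hc.is_comm.comm }
  have hmem : ∀ x ∈ s, x ∈ Algebra.adjoin ℂ s := fun x hx => Algebra.subset_adjoin hx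
  let a' : Algebra.adjoin ℂ s := ⟨a, hmem a (by simp [s])⟩
  let y' : Algebra.adjoin ℂ s := ⟨y, hmem y (by simp [s])⟩
  let p' : Algebra.adjoin ℂ s := ⟨p, hmem p (by simp [s])⟩
  let r' : Algebra.adjoin ℂ s := ⟨r, hmem r (by simp [s])⟩
  let z' : Algebra.adjoin ℂ s := z • 1
  let w' : Algebra.adjoin ℂ s := w • 1
  let b' : Algebra.adjoin ℂ s := a' * y' - y' * y'
  have hb' : (b' : 𝒜) = b := by
    change a * y - y * y = b
    rw [hy]; abel
  have hq : ∀ v : ℂ, (((v • 1) ^ 2 - (v • 1) * a' + b' : Algebra.adjoin ℂ s) : 𝒜) =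
      quadPencil a b v := by
    intro v
    change (v • (1 : 𝒜)) ^ 2 - (v • 1) * a + (b' : 𝒜) = _
    rw [hb', quadPencil, smul_pow, one_pow, smul_mul_assoc, one_mul]
  have h := resolvent_equation_comm (z := z') (w := w') (a := a') (b := b') (y := y') (p := p')
    (r := r') (Subtype.ext (by
      change p * _ = 1
      rw [hq, hp])) (Subtype.ext (by
      change r * _ = 1
      rw [hq, hr])) (by simp only [b']; abel)
  have h' := congrArg Subtype.val h
  change (z • (1 : 𝒜) - w • 1) * ((z • 1 - y) * p ^ 3 * ((w • 1 - y) * r)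
      + (z • 1 - y) * p * ((w • 1 - y) * r ^ 3)
      + (z • 1 - y) * p ^ 2 * ((w • 1 - y) * r ^ 2) + p ^ 2 * r + p * r ^ 2) =
      (w • 1 - y) * r ^ 3 - (z • 1 - y) * p ^ 3 at h'
  rw [← h', ← sub_smul, smul_mul_assoc, one_mul]

/-- The resolvent equation behind the product rule. -/
theorem FineOp.kernel_resolvent_equation {a b y : 𝒜} (hab : Commute a b) (hay : Commute a y)
    (hby : Commute b y) (hy : y * y = a * y - b) {z w : ℂ} (hz : z ∉ quadSpectrum a b)
    (hw : w ∉ quadSpectrum a b) :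
    (z - w) • (FineOp.kernel .ΔΔ a b y z * FineOp.kernel .id a b y w
      + FineOp.kernel .id a b y z * FineOp.kernel .ΔΔ a b y w
      + FineOp.kernel .Δ a b y z * FineOp.kernel .Δ a b y w
      - FineOp.kernel .ΔD a b y z * FineOp.kernel .D a b y w
      - FineOp.kernel .D a b y z * FineOp.kernel .ΔD a b y w) =
      FineOp.kernel .ΔΔ a b y w - FineOp.kernel .ΔΔ a b y z := by
  have hqz := Ring.inverse_mul_cancel _ (not_not.mp hz)
  have hqw := Ring.inverse_mul_cancel _ (not_not.mp hw)
  have hA : ∀ v, Commute a (Ring.inverse (quadPencil a b v)) := fun v =>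
    ((Commute.refl a).inverse_quadPencil_left hab.symm v).symm
  have hB : ∀ v, Commute b (Ring.inverse (quadPencil a b v)) := fun v =>
    (hab.inverse_quadPencil_left (Commute.refl b) v).symm
  have hY : ∀ v, Commute y (Ring.inverse (quadPencil a b v)) := fun v =>
    (hay.inverse_quadPencil_left hby v).symm
  -- The normalizing constants all agree: `64 · 1`, `(-8)²`, and `16 · (-4) = -64`, whence the minus
  -- signs of the last two terms.
  have h := congrArg (fun x => (64 : ℂ) • x) (resolvent_equation hay hqz hqw (hA z) (hY z)
    (hA w) (hY w) ((hA w).inverse_quadPencil_left (hB w) z) hy)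
  simp only [FineOp.kernel, smul_mul_assoc, mul_smul_comm, smul_smul] at h ⊢
  rw [← smul_sub, ← h]
  module

end Kernels

/-! ### Axially symmetric sets and their slices -/

section Domains

theorem neg_mem_imagSphere {J : R6} (hJ : J ∈ imagSphere) : -J ∈ imagSphere :=
  ⟨by simp [hJ.1], by rw [norm_neg, hJ.2]⟩

/-- Conjugation amounts to replacing `J` by `-J`, again an imaginary unit; hence slices of axially
symmetric sets are symmetric about the real axis. -/
theorem slicePoint_conj (J : R6) (z : ℂ) :
    slicePoint J (starRingEnd ℂ z) = slicePoint (-J) z := by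
  simp [slicePoint]

theorem continuous_slicePoint (J : R6) : Continuous (slicePoint J) := by
  have h : ∀ z, slicePoint J z = z.re • EuclideanSpace.single (0 : Fin 6) (1 : ℝ) + z.im • J := by
    intro z
    ext i
    simp [slicePoint, PiLp.single_apply]
  simp only [funext h]
  fun_prop

theorem stemDomain_eq_sliceOf {U : Set R6} (hU : AxiallySymmetric U) {J : R6}
    (hJ : J ∈ imagSphere) : stemDomain U = sliceOf J U :=
  Subset.antisymm (fun _ hz => hz J hJ) fun z hz I hI => hU z J hJ I hI hz

theorem conj_mem_stemDomain {U : Set R6} {z : ℂ} (hz : z ∈ stemDomain U) :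
    starRingEnd ℂ z ∈ stemDomain U := fun J hJ => by
  rw [slicePoint_conj]
  exact hz _ (neg_mem_imagSphere hJ)

theorem isOpen_sliceOf {U : Set R6} (hU : IsOpen U) (J : R6) : IsOpen (sliceOf J U) :=
  hU.preimage (continuous_slicePoint J)

theorem closure_sliceOf_subset (U : Set R6) (J : R6) :
    closure (sliceOf J U) ⊆ sliceOf J (closure U) :=
  (continuous_slicePoint J).closure_preimage_subset U

theorem isBounded_sliceOf {U : Set R6} (hU : Bornology.IsBounded U) {J : R6}
    (hJ : J ∈ imagSphere) : Bornology.IsBounded (sliceOf J U) := by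
  obtain ⟨R, hR⟩ := hU.exists_norm_le
  -- The real part is at most `R` in absolute value, and the imaginary part at most `2 R` by the
  -- triangle inequality.
  refine isBounded_iff_forall_norm_le.mpr ⟨3 * R, fun z hz => ?_⟩
  have h1 : ‖slicePoint J z‖ ≤ R := hR _ hz
  have h2 : |z.re| ≤ R := by
    have h3 : (slicePoint J z) 0 = z.re := by simp [slicePoint, hJ.1]
    rw [← h3, ← Real.norm_eq_abs]
    exact (PiLp.norm_apply_le _ _).trans h1
  have h4 : |z.im| ≤ R + R := by
    have h5 : z.im • J = slicePoint J z - EuclideanSpace.single (0 : Fin 6) z.re := by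
      simp [slicePoint]
    have h6 : ‖z.im • J‖ = |z.im| := by rw [norm_smul, hJ.2, mul_one, Real.norm_eq_abs]
    rw [← h6, h5]
    refine (norm_sub_le _ _).trans (add_le_add h1 ?_)
    simpa using h2
  linarith [norm_le_abs_re_add_abs_im z]

end Domains

/-! ### Integrals along the boundary and along its conjugate -/

section Curves

/-- Inside each piece `deriv` is the continuous one-sided-closed derivative of that piece; the
finitely many break points, where `deriv` may be junk, form a null set. -/
theorem IsJordanCurve.intervalIntegrable_deriv {γ : ℝ → ℂ} (hγ : IsJordanCurve γ) :
    IntervalIntegrable (deriv γ) volume 0 1 := by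
  obtain ⟨n, t, ht, h0, h1, hC⟩ := hγ.piecewise
  have hpiece : ∀ i : Fin n, IntervalIntegrable (deriv γ) volume (t i.castSucc) (t i.succ) := by
    intro i
    have hlt : t i.castSucc < t i.succ := ht i.castSucc_lt_succ
    have hc := (hC i).continuousOn_derivWithin (uniqueDiffOn_Icc hlt) le_rfl
    rw [intervalIntegrable_iff_integrableOn_Ioo_of_le hlt.le]
    refine ((hc.integrableOn_Icc).mono_set Ioo_subset_Icc_self).congr_fun (fun s hs => ?_)
      measurableSet_Ioo
    exact derivWithin_of_mem_nhds (Icc_mem_nhds hs.1 hs.2)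
  have hall : ∀ i : Fin (n + 1), IntervalIntegrable (deriv γ) volume (t 0) (t i) := by
    intro i
    induction i using Fin.induction with
    | zero => exact IntervalIntegrable.refl
    | succ i ih => exact ih.trans (hpiece i)
  have := hall (Fin.last n)
  rwa [h0, h1] at this

theorem intervalIntegrable_smul_comp {E : Type*} [NormedAddCommGroup E] [NormedSpace ℂ E]
    {γ δ : ℝ → ℂ} {D : Set ℂ} {h : ℂ → E} (hγ : ContinuousOn γ (Icc 0 1))
    (hδ : IntervalIntegrable δ volume 0 1) (hD : ∀ t ∈ Icc (0 : ℝ) 1, γ t ∈ D)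
    (hh : ContinuousOn h D) : IntervalIntegrable (fun t => δ t • h (γ t)) volume 0 1 := by
  refine hδ.smul_continuousOn ?_
  rw [uIcc_of_le zero_le_one]
  exact hh.comp hγ hD

theorem IsJordanBoundary.mem_frontier {Ω : Set ℂ} {m : ℕ} {γ : Fin m → ℝ → ℂ}
    (hγ : IsJordanBoundary Ω γ) (k : Fin m) {t : ℝ} (ht : t ∈ Icc (0 : ℝ) 1) :
    γ k t ∈ frontier Ω := by
  rw [← hγ.union_eq]
  exact mem_iUnion.mpr ⟨k, mem_image_of_mem _ ht⟩

theorem sum_integral_eq_of_windingNumber {m : ℕ} (γ : Fin m → ℝ → ℂ) (w : ℂ) :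
    ∑ k, ∫ t in (0 : ℝ)..1, deriv (γ k) t / (γ k t - w) = 2 * π * I * windingNumber γ w := by
  rw [windingNumber, mul_inv_cancel_left₀ two_pi_I_ne_zero]

theorem conj_mem_frontier {Ω : Set ℂ} (hΩ : ∀ z ∈ Ω, starRingEnd ℂ z ∈ Ω) {z : ℂ}
    (hz : z ∈ frontier Ω) : starRingEnd ℂ z ∈ frontier Ω := by
  have h : conjCLE.toHomeomorph ⁻¹' Ω = Ω := by
    ext z
    exact ⟨fun h => by simpa using hΩ _ h, fun h => hΩ _ h⟩
  have h1 := conjCLE.toHomeomorph.preimage_frontier Ω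
  rw [h] at h1
  rw [← h1] at hz
  exact hz

theorem sum_integral_conj {m : ℕ} (γ : Fin m → ℝ → ℂ) (w : ℂ) :
    ∑ k, ∫ t in (0 : ℝ)..1, -starRingEnd ℂ (deriv (γ k) t) / (starRingEnd ℂ (γ k t) - w) =
      -starRingEnd ℂ (∑ k, ∫ t in (0 : ℝ)..1,
        deriv (γ k) t / (γ k t - starRingEnd ℂ w)) := by
  rw [map_sum, ← Finset.sum_neg_distrib]
  refine Finset.sum_congr rfl fun k _ => ?_
  rw [intervalIntegral.integral_of_le zero_le_one, intervalIntegral.integral_of_le zero_le_one,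
    ← integral_conj, ← integral_neg]
  congr 1
  ext t
  simp [neg_div]

variable {E : Type*} [NormedAddCommGroup E] [NormedSpace ℂ E] [CompleteSpace E]
  {Ω W σ : Set ℂ} {m : ℕ} {γ : Fin m → ℝ → ℂ} {h : ℂ → E} {φ : ℂ → ℂ}

theorem boundary_integral_eq (hγ : IsJordanBoundary Ω γ) (hor : PositivelyOriented Ω γ)
    (hΩ : IsOpen Ω) (hΩb : Bornology.IsBounded Ω) (hW : IsOpen W) (hΩW : closure Ω ⊆ W)
    (hσ : IsClosed σ) (hh : DifferentiableOn ℂ h (W \ σ)) (hφ : IsCutoff σ Ω φ) :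
    ∑ k, ∫ t in (0 : ℝ)..1, deriv (γ k) t • h (γ k t) = -(2 * I) • ∫ w, dbar φ w • h w := by
  refine cycle_integral_eq (fun k => (hγ.jordan k).continuousOn)
    (fun k => (hγ.jordan k).intervalIntegrable_deriv) (fun k t ht => hγ.mem_frontier k ht) hΩ hΩb hW
    hΩW (fun w hw => ?_) (fun w hw => ?_) hσ hh hφ
  · rw [sum_integral_eq_of_windingNumber, hor.1 w hw, mul_one]
  · rw [sum_integral_eq_of_windingNumber, hor.2 w hw, mul_zero]

theorem intervalIntegrable_conj {δ : ℝ → ℂ} (hδ : IntervalIntegrable δ volume 0 1) :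
    IntervalIntegrable (fun t => starRingEnd ℂ (δ t)) volume 0 1 :=
  ⟨conjCLE.toContinuousLinearMap.integrable_comp hδ.1,
    conjCLE.toContinuousLinearMap.integrable_comp hδ.2⟩

/-- Conjugation preserves `Ω` but reverses orientation. With the density `-γ̄'` the conjugate cycle
has the winding integrals of a positively oriented boundary, so the result is the negative of that
for `γ`. -/
theorem conj_boundary_integral_eq (hγ : IsJordanBoundary Ω γ) (hor : PositivelyOriented Ω γ)
    (hΩ : IsOpen Ω) (hΩb : Bornology.IsBounded Ω) (hΩc : ∀ z ∈ Ω, starRingEnd ℂ z ∈ Ω)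
    (hW : IsOpen W) (hΩW : closure Ω ⊆ W)
    (hσ : IsClosed σ) (hh : DifferentiableOn ℂ h (W \ σ)) (hφ : IsCutoff σ Ω φ) :
    ∑ k, ∫ t in (0 : ℝ)..1, starRingEnd ℂ (deriv (γ k) t) • h (starRingEnd ℂ (γ k t)) =
      (2 * I) • ∫ w, dbar φ w • h w := by
  have hcl : ∀ w, starRingEnd ℂ w ∈ closure Ω → w ∈ closure Ω := by
    intro w hw
    have h1 : closure Ω ⊆ starRingEnd ℂ ⁻¹' closure Ω :=
      closure_minimal (fun z hz => subset_closure (hΩc z hz)) (isClosed_closure.preimage continuous_conj)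
    simpa using h1 hw
  have := cycle_integral_eq (γ := fun k t => starRingEnd ℂ (γ k t))
    (δ := fun k t => -starRingEnd ℂ (deriv (γ k) t))
    (fun k => continuous_conj.comp_continuousOn (hγ.jordan k).continuousOn)
    (fun k => (intervalIntegrable_conj (hγ.jordan k).intervalIntegrable_deriv).neg)
    (fun k t ht => conj_mem_frontier hΩc (hγ.mem_frontier k ht)) hΩ hΩb hW
    hΩW (fun w hw => ?_) (fun w hw => ?_) hσ hh hφ
  · simp only [neg_smul, intervalIntegral.integral_neg, Finset.sum_neg_distrib] at this
    exact neg_injective this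
  · rw [sum_integral_conj, sum_integral_eq_of_windingNumber, hor.1 _ (hΩc w hw), mul_one]
    simp [map_ofNat (starRingEnd ℂ) 2]
  · rw [sum_integral_conj, sum_integral_eq_of_windingNumber, hor.2 _ (fun h => hw (hcl w h)), mul_zero]
    simp

end Curves

/-! ### Resolvent operators in the complex algebra -/

section Representation

variable {V : Type*} [NormedAddCommGroup V] [NormedSpace ℝ V]
  {𝒜 : Type*} [NormedRing 𝒜] [NormedAlgebra ℂ 𝒜]

/-- `ρ` is a homomorphism of algebras which is a homeomorphism onto its image. -/
structure IsEmbeddingRep (ρ : Cliff (V →L[ℝ] V) →L[ℝ] 𝒜) : Prop where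
  map_one : ρ 1 = 1
  map_mul : ∀ a b, ρ (a * b) = ρ a * ρ b
  antilipschitz : ∃ K, AntilipschitzWith K ρ

/-- The image of `T + T̄`. -/
noncomputable def repTrace (ρ : Cliff (V →L[ℝ] V) →L[ℝ] 𝒜) (T : Fin 6 → V →L[ℝ] V) : 𝒜 :=
  ρ (paravector T + paravectorConj T)

/-- The image of `T T̄`. -/
noncomputable def repNorm (ρ : Cliff (V →L[ℝ] V) →L[ℝ] 𝒜) (T : Fin 6 → V →L[ℝ] V) : 𝒜 :=
  ρ (paravector T * paravectorConj T)

/-- The image of `T̄`. -/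
noncomputable def repConj (ρ : Cliff (V →L[ℝ] V) →L[ℝ] 𝒜) (T : Fin 6 → V →L[ℝ] V) : 𝒜 :=
  ρ (paravectorConj T)

/-- The image of the imaginary unit `J`. -/
noncomputable def repUnit (ρ : Cliff (V →L[ℝ] V) →L[ℝ] 𝒜) (J : R6) : 𝒜 :=
  ρ (J.toCliff.toOp V)

variable {ρ : Cliff (V →L[ℝ] V) →L[ℝ] 𝒜} {T : Fin 6 → V →L[ℝ] V}

theorem IsEmbeddingRep.commute (hρ : IsEmbeddingRep ρ) {a b : Cliff (V →L[ℝ] V)}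
    (h : Commute a b) : Commute (ρ a) (ρ b) := by
  rw [commute_iff_eq, ← hρ.map_mul, ← hρ.map_mul, h.eq]

theorem IsEmbeddingRep.map_real_smul (r : ℝ) (a : Cliff (V →L[ℝ] V)) :
    ρ (r • a) = (r : ℂ) • ρ a := by
  rw [map_smul, Complex.coe_smul]

theorem IsEmbeddingRep.map_pow (hρ : IsEmbeddingRep ρ) (a : Cliff (V →L[ℝ] V)) (n : ℕ) :
    ρ (a ^ n) = ρ a ^ n := by
  induction n with
  | zero => rw [pow_zero, pow_zero, hρ.map_one]
  | succ n ih => rw [pow_succ, pow_succ, hρ.map_mul, ih]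

theorem IsEmbeddingRep.injective (hρ : IsEmbeddingRep ρ) : Function.Injective ρ :=
  hρ.antilipschitz.choose_spec.injective

theorem IsEmbeddingRep.map_toOp_mono_empty (hρ : IsEmbeddingRep ρ) (r : ℝ) :
    ρ ((Cliff.mono ∅ r).toOp V) = (r : ℂ) • 1 := by
  rw [Cliff.toOp_mono, Cliff.mono_empty_smul_one, IsEmbeddingRep.map_real_smul, hρ.map_one]

theorem repUnit_mul_self (hρ : IsEmbeddingRep ρ) {J : R6} (hJ : J ∈ imagSphere) :
    repUnit ρ J * repUnit ρ J = -1 := by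
  rw [repUnit, ← hρ.map_mul, ← Cliff.toOp_mul, toCliff_mul_self hJ, Cliff.toOp_neg,
    Cliff.toOp_one, map_neg, hρ.map_one]

theorem commute_repTrace (hρ : IsEmbeddingRep ρ) {c : Cliff (V →L[ℝ] V)}
    (hc : ∀ A, Commute (T 0) (c A)) : Commute (repTrace ρ T) (ρ c) := by
  refine hρ.commute ?_
  rw [paravector_add_conj]
  exact Cliff.commute_mono_empty fun A => (hc A).add_left (hc A)

theorem commute_repNorm (hρ : IsEmbeddingRep ρ) (hT : ∀ i j, Commute (T i) (T j))
    {c : Cliff (V →L[ℝ] V)} (hc : ∀ i A, Commute (T i) (c A)) :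
    Commute (repNorm ρ T) (ρ c) := by
  refine hρ.commute ?_
  rw [paravector_mul_conj T hT]
  exact Cliff.commute_mono_empty fun A =>
    Commute.sum_left _ _ _ fun i _ => (hc i A).mul_left (hc i A)

theorem commute_repTrace_repUnit (hρ : IsEmbeddingRep ρ) (J : R6) :
    Commute (repTrace ρ T) (repUnit ρ J) :=
  commute_repTrace hρ fun A => Cliff.commute_toOp_apply V _ _ A

theorem commute_repNorm_repUnit (hρ : IsEmbeddingRep ρ) (hT : ∀ i j, Commute (T i) (T j)) (J : R6) :
    Commute (repNorm ρ T) (repUnit ρ J) :=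
  commute_repNorm hρ hT fun _ A => Cliff.commute_toOp_apply V _ _ A

theorem commute_repTrace_repConj (hρ : IsEmbeddingRep ρ) (hT : ∀ i j, Commute (T i) (T j)) :
    Commute (repTrace ρ T) (repConj ρ T) :=
  commute_repTrace hρ fun A => commute_paravectorConj_apply (hT 0) A

theorem commute_repNorm_repConj (hρ : IsEmbeddingRep ρ) (hT : ∀ i j, Commute (T i) (T j)) :
    Commute (repNorm ρ T) (repConj ρ T) :=
  commute_repNorm hρ hT fun i A => commute_paravectorConj_apply (hT i) A

/-- Just `(T + T̄) T̄ = T T̄ + T̄²`; this quadratic relation is what drives the resolvent equation.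
-/
theorem repConj_mul_self (hρ : IsEmbeddingRep ρ) :
    repConj ρ T * repConj ρ T = repTrace ρ T * repConj ρ T - repNorm ρ T := by
  rw [repTrace, repNorm, repConj, ← hρ.map_mul, ← hρ.map_mul, ← map_sub, add_mul,
    add_sub_cancel_left]

theorem commute_repTrace_repNorm (hρ : IsEmbeddingRep ρ) (hT : ∀ i j, Commute (T i) (T j)) :
    Commute (repTrace ρ T) (repNorm ρ T) := by
  have hy := commute_repTrace_repConj hρ hT
  have h : repNorm ρ T = repTrace ρ T * repConj ρ T - repConj ρ T * repConj ρ T := by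
    rw [repConj_mul_self hρ]; abel
  rw [h]
  exact ((Commute.refl _).mul_right hy).sub_right (hy.mul_right hy)

theorem rep_slice_value (hρ : IsEmbeddingRep ρ) (J : R6) (r s : ℝ) :
    ρ ((Cliff.mono ∅ r + J.toCliff * Cliff.mono ∅ s).toOp V) =
      splitRight (repUnit ρ J) ((r + s * I : ℂ) • 1) ((r - s * I : ℂ) • 1) := by
  rw [Cliff.toOp_add, Cliff.toOp_mul, map_add, hρ.map_mul, hρ.map_toOp_mono_empty,
    hρ.map_toOp_mono_empty, mul_smul_comm, mul_one]
  exact splitRight_complex _ r s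

theorem rep_slicePoint (hρ : IsEmbeddingRep ρ) {J : R6} (hJ : J ∈ imagSphere) (z : ℂ) :
    ρ ((slicePoint J z).toCliff.toOp V) =
      splitRight (repUnit ρ J) (z • 1) (starRingEnd ℂ z • 1) := by
  have h : (z.re - z.im * I : ℂ) = starRingEnd ℂ z := by apply Complex.ext <;> simp
  rw [toCliff_slicePoint hJ, rep_slice_value hρ, re_add_im, h]

theorem rep_Qc (hρ : IsEmbeddingRep ρ) {J : R6} (hJ : J ∈ imagSphere) (z : ℂ) :
    ρ (Qc T (slicePoint J z)) = splitRight (repUnit ρ J)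
      (quadPencil (repTrace ρ T) (repNorm ρ T) z)
      (quadPencil (repTrace ρ T) (repNorm ρ T) (starRingEnd ℂ z)) := by
  have hj := repUnit_mul_self hρ hJ
  have ha := commute_repTrace_repUnit (T := T) hρ J
  have h1 : ρ (paravector T + paravectorConj T) =
      splitRight (repUnit ρ J) (repTrace ρ T) (repTrace ρ T) := (splitRight_self _ _).symm
  have h2 : ρ (paravector T * paravectorConj T) =
      splitRight (repUnit ρ J) (repNorm ρ T) (repNorm ρ T) := (splitRight_self _ _).symm
  rw [Qc, map_add, map_sub, hρ.map_pow, hρ.map_mul, rep_slicePoint hρ hJ, h1, h2, sq,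
    splitRight_mul hj (commute_smul_one _ _) (commute_smul_one _ _), splitRight_mul hj ha ha,
    splitRight_sub, splitRight_add]
  simp only [quadPencil, one_mul, smul_mul_assoc, smul_smul, sq]

/-- The operator `𝓠` at `z` sees the pencil at `z` only on the part where `j` acts as `i`; on the
other part it is seen by `𝓠` at `z̄`. The inverses of the two, each cut down by its idempotent, add
up to an inverse of the pencil, on either side. -/
theorem isUnit_quadPencil (hρ : IsEmbeddingRep ρ) (hT : ∀ i j, Commute (T i) (T j)) {J : R6}
    (hJ : J ∈ imagSphere) {z : ℂ} (h1 : IsUnit (Qc T (slicePoint J z)))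
    (h2 : IsUnit (Qc T (slicePoint J (starRingEnd ℂ z)))) :
    IsUnit (quadPencil (repTrace ρ T) (repNorm ρ T) z) := by
  have hj := repUnit_mul_self hρ hJ
  set j := repUnit ρ J
  have hqj : ∀ w, Commute (quadPencil (repTrace ρ T) (repNorm ρ T) w) j := fun w =>
    (commute_repTrace_repUnit hρ J).quadPencil_left (commute_repNorm_repUnit hρ hT J) w
  have e1 := rep_Qc (T := T) hρ hJ z
  have e2 := rep_Qc (T := T) hρ hJ (starRingEnd ℂ z)
  rw [conj_conj] at e2
  set q := quadPencil (repTrace ρ T) (repNorm ρ T) z with hq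
  set q' := quadPencil (repTrace ρ T) (repNorm ρ T) (starRingEnd ℂ z)
  have hqq : Commute q j := hqj z
  set A := ρ (Ring.inverse (Qc T (slicePoint J z)))
  set A' := ρ (Ring.inverse (Qc T (slicePoint J (starRingEnd ℂ z))))
  have hA1 : splitRight j q q' * A = 1 := by
    rw [← e1, ← hρ.map_mul, Ring.mul_inverse_cancel _ h1, hρ.map_one]
  have hA2 : A * splitRight j q q' = 1 := by
    rw [← e1, ← hρ.map_mul, Ring.inverse_mul_cancel _ h1, hρ.map_one]
  have hB1 : splitRight j q' q * A' = 1 := by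
    rw [← e2, ← hρ.map_mul, Ring.mul_inverse_cancel _ h2, hρ.map_one]
  have hB2 : A' * splitRight j q' q = 1 := by
    rw [← e2, ← hρ.map_mul, Ring.inverse_mul_cancel _ h2, hρ.map_one]
  have c1 : splitRight j q q' * idemPos j = q * idemPos j := by
    rw [splitRight, add_mul, mul_assoc, mul_assoc, idemPos_mul_self hj, idemNeg_mul_idemPos hj,
      mul_zero, add_zero]
  have c2 : splitRight j q' q * idemNeg j = q * idemNeg j := by
    rw [splitRight, add_mul, mul_assoc, mul_assoc, idemNeg_mul_self hj, idemPos_mul_idemNeg hj,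
      mul_zero, zero_add]
  have d1 : idemPos j * splitRight j q q' = idemPos j * q := by
    rw [splitRight_eq_splitLeft hqq (hqj _), splitLeft, mul_add, ← mul_assoc, ← mul_assoc,
      idemPos_mul_self hj, idemPos_mul_idemNeg hj, zero_mul, add_zero]
  have d2 : idemNeg j * splitRight j q' q = idemNeg j * q := by
    rw [splitRight_eq_splitLeft (hqj _) hqq, splitLeft, mul_add, ← mul_assoc, ← mul_assoc,
      idemNeg_mul_self hj, idemNeg_mul_idemPos hj, zero_mul, zero_add]
  refine isUnit_iff_exists_and_exists.mpr
    ⟨⟨idemPos j * A + idemNeg j * A', ?_⟩, A * idemPos j + A' * idemNeg j, ?_⟩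
  · rw [mul_add, ← mul_assoc, ← mul_assoc, hqq.idemPos_right.eq, hqq.idemNeg_right.eq, ← d1, ← d2,
      mul_assoc, mul_assoc, hA1, hB1, mul_one, mul_one, idemPos_add_idemNeg]
  · rw [add_mul, mul_assoc, mul_assoc, ← hqq.idemPos_right.eq, ← hqq.idemNeg_right.eq, ← c1, ← c2,
      ← mul_assoc, ← mul_assoc, hA2, hB2, one_mul, one_mul, idemPos_add_idemNeg]

theorem rep_QcInv (hρ : IsEmbeddingRep ρ) (hT : ∀ i j, Commute (T i) (T j)) {J : R6}
    (hJ : J ∈ imagSphere) {z : ℂ} (h1 : IsUnit (Qc T (slicePoint J z)))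
    (h2 : IsUnit (Qc T (slicePoint J (starRingEnd ℂ z)))) :
    ρ (QcInv T (slicePoint J z)) = splitRight (repUnit ρ J)
      (Ring.inverse (quadPencil (repTrace ρ T) (repNorm ρ T) z))
      (Ring.inverse (quadPencil (repTrace ρ T) (repNorm ρ T) (starRingEnd ℂ z))) := by
  have hj := repUnit_mul_self hρ hJ
  have hu := isUnit_quadPencil hρ hT hJ h1 h2
  have hu' := isUnit_quadPencil (z := starRingEnd ℂ z) hρ hT hJ h2 (by rwa [conj_conj])
  have hqj : ∀ w, Commute (Ring.inverse (quadPencil (repTrace ρ T) (repNorm ρ T) w))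
      (repUnit ρ J) := fun w =>
    (commute_repTrace_repUnit hρ J).inverse_quadPencil_left (commute_repNorm_repUnit hρ hT J) w
  refine left_inv_eq_right_inv (a := ρ (Qc T (slicePoint J z))) ?_ ?_
  · rw [← hρ.map_mul, QcInv, Ring.inverse_mul_cancel _ h1, hρ.map_one]
  · rw [rep_Qc hρ hJ, splitRight_mul hj (hqj _) (hqj _), Ring.mul_inverse_cancel _ hu,
      Ring.mul_inverse_cancel _ hu', splitRight_self]

variable (ρ T) in
/-- The kernel of `P` in the representation `ρ`. -/
noncomputable def FineOp.repKernel (P : FineOp) : ℂ → 𝒜 :=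
  P.kernel (repTrace ρ T) (repNorm ρ T) (repConj ρ T)

/-- The powers of `𝓠⁻¹` have components that commute with `j`, so they may stand on the right of `s
- T̄`, whose components need not commute with `j`. -/
theorem rep_resolventLeft (hρ : IsEmbeddingRep ρ) (hT : ∀ i j, Commute (T i) (T j)) {J : R6}
    (hJ : J ∈ imagSphere) {z : ℂ} (h1 : IsUnit (Qc T (slicePoint J z)))
    (h2 : IsUnit (Qc T (slicePoint J (starRingEnd ℂ z)))) (P : FineOp) :
    ρ (P.resolventLeft T (slicePoint J z)) = splitRight (repUnit ρ J)
      (P.repKernel ρ T z) (P.repKernel ρ T (starRingEnd ℂ z)) := by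
  have hj := repUnit_mul_self hρ hJ
  have hq := rep_QcInv hρ hT hJ h1 h2
  have hc : ∀ w, Commute (Ring.inverse (quadPencil (repTrace ρ T) (repNorm ρ T) w))
      (repUnit ρ J) := fun w =>
    (commute_repTrace_repUnit hρ J).inverse_quadPencil_left (commute_repNorm_repUnit hρ hT J) w
  have hy : ρ ((slicePoint J z).toCliff.toOp V - paravectorConj T) = splitRight (repUnit ρ J)
      (z • 1 - repConj ρ T) (starRingEnd ℂ z • 1 - repConj ρ T) := by
    rw [map_sub, rep_slicePoint hρ hJ, ← splitRight_sub, splitRight_self, repConj]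
  have hpow : ∀ n : ℕ, ρ (QcInv T (slicePoint J z) ^ n) = splitRight (repUnit ρ J)
      (Ring.inverse (quadPencil (repTrace ρ T) (repNorm ρ T) z) ^ n)
      (Ring.inverse (quadPencil (repTrace ρ T) (repNorm ρ T) (starRingEnd ℂ z)) ^ n) := by
    intro n
    induction n with
    | zero => simp only [pow_zero, hρ.map_one, splitRight_self]
    | succ n ih => simp only [pow_succ, hρ.map_mul, ih, hq, splitRight_mul hj (hc _) (hc _)]
  have hmul : ∀ n : ℕ, ρ (((slicePoint J z).toCliff.toOp V - paravectorConj T) *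
      QcInv T (slicePoint J z) ^ n) = splitRight (repUnit ρ J)
      ((z • 1 - repConj ρ T) * Ring.inverse (quadPencil (repTrace ρ T) (repNorm ρ T) z) ^ n)
      ((starRingEnd ℂ z • 1 - repConj ρ T) *
        Ring.inverse (quadPencil (repTrace ρ T) (repNorm ρ T) (starRingEnd ℂ z)) ^ n) := fun n => by
    rw [hρ.map_mul, hy, hpow, splitRight_mul hj ((hc _).pow_left n) ((hc _).pow_left n)]
  cases P
  · have h := hmul 1
    simp only [pow_one] at h
    exact h
  · simp only [FineOp.resolventLeft, FineOp.repKernel, FineOp.kernel,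
      IsEmbeddingRep.map_real_smul, hq, smul_splitRight]
    norm_num
  · simp only [FineOp.resolventLeft, FineOp.repKernel, FineOp.kernel, scResolventLeft, mul_assoc,
      ← sq, IsEmbeddingRep.map_real_smul, hmul, smul_splitRight]
    norm_num
  · simp only [FineOp.resolventLeft, FineOp.repKernel, FineOp.kernel,
      IsEmbeddingRep.map_real_smul, hpow, smul_splitRight]
    norm_num
  · simp only [FineOp.resolventLeft, FineOp.repKernel, FineOp.kernel,
      IsEmbeddingRep.map_real_smul, hmul, smul_splitRight]
    norm_num

/-- The mirror image, with the idempotents on the left. Since `T̄` commutes with the inverse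
pencils, the components are the same kernels as for the left resolvents; hence both forms of the
calculus agree on intrinsic functions. -/
theorem rep_resolventRight (hρ : IsEmbeddingRep ρ) (hT : ∀ i j, Commute (T i) (T j)) {J : R6}
    (hJ : J ∈ imagSphere) {z : ℂ} (h1 : IsUnit (Qc T (slicePoint J z)))
    (h2 : IsUnit (Qc T (slicePoint J (starRingEnd ℂ z)))) (P : FineOp) :
    ρ (P.resolventRight T (slicePoint J z)) = splitLeft (repUnit ρ J)
      (P.repKernel ρ T z) (P.repKernel ρ T (starRingEnd ℂ z)) := by
  have hj := repUnit_mul_self hρ hJ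
  have hc : ∀ w, Commute (Ring.inverse (quadPencil (repTrace ρ T) (repNorm ρ T) w))
      (repUnit ρ J) := fun w =>
    (commute_repTrace_repUnit hρ J).inverse_quadPencil_left (commute_repNorm_repUnit hρ hT J) w
  have hcy : ∀ (w : ℂ) (n : ℕ), Ring.inverse (quadPencil (repTrace ρ T) (repNorm ρ T) w) ^ n *
      (w • 1 - repConj ρ T) = (w • 1 - repConj ρ T) *
        Ring.inverse (quadPencil (repTrace ρ T) (repNorm ρ T) w) ^ n := fun w n =>
    ((commute_smul_one w _).symm.sub_right ((commute_repTrace_repConj hρ hT).inverse_quadPencil_left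
      (commute_repNorm_repConj hρ hT) w)).pow_left n
  have hq : ρ (QcInv T (slicePoint J z)) = _ :=
    (rep_QcInv hρ hT hJ h1 h2).trans (splitRight_eq_splitLeft (hc _) (hc _))
  have hy : ρ ((slicePoint J z).toCliff.toOp V - paravectorConj T) = splitLeft (repUnit ρ J)
      (z • 1 - repConj ρ T) (starRingEnd ℂ z • 1 - repConj ρ T) := by
    rw [map_sub, rep_slicePoint hρ hJ,
      splitRight_eq_splitLeft (commute_smul_one _ _) (commute_smul_one _ _), ← splitLeft_sub,
      splitLeft_self, repConj]
  have hpow : ∀ n : ℕ, ρ (QcInv T (slicePoint J z) ^ n) = splitLeft (repUnit ρ J)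
      (Ring.inverse (quadPencil (repTrace ρ T) (repNorm ρ T) z) ^ n)
      (Ring.inverse (quadPencil (repTrace ρ T) (repNorm ρ T) (starRingEnd ℂ z)) ^ n) := by
    intro n
    induction n with
    | zero => simp only [pow_zero, hρ.map_one, splitLeft_self]
    | succ n ih => simp only [pow_succ', hρ.map_mul, ih, hq, splitLeft_mul hj (hc _) (hc _)]
  have hmul : ∀ n : ℕ, ρ (QcInv T (slicePoint J z) ^ n *
      ((slicePoint J z).toCliff.toOp V - paravectorConj T)) = splitLeft (repUnit ρ J)
      ((z • 1 - repConj ρ T) * Ring.inverse (quadPencil (repTrace ρ T) (repNorm ρ T) z) ^ n)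
      ((starRingEnd ℂ z • 1 - repConj ρ T) *
        Ring.inverse (quadPencil (repTrace ρ T) (repNorm ρ T) (starRingEnd ℂ z)) ^ n) := fun n => by
    rw [hρ.map_mul, hy, hpow, splitLeft_mul hj ((hc _).pow_left n) ((hc _).pow_left n), hcy, hcy]
  cases P
  · have h := hmul 1
    simp only [pow_one] at h
    exact h
  · simp only [FineOp.resolventRight, FineOp.repKernel, FineOp.kernel,
      IsEmbeddingRep.map_real_smul, hq, smul_splitLeft]
    norm_num
  · simp only [FineOp.resolventRight, FineOp.repKernel, FineOp.kernel, scResolventRight,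
      ← mul_assoc, ← sq, IsEmbeddingRep.map_real_smul, hmul, smul_splitLeft]
    norm_num
  · simp only [FineOp.resolventRight, FineOp.repKernel, FineOp.kernel,
      IsEmbeddingRep.map_real_smul, hpow, smul_splitLeft]
    norm_num
  · simp only [FineOp.resolventRight, FineOp.repKernel, FineOp.kernel,
      IsEmbeddingRep.map_real_smul, hmul, smul_splitLeft]
    norm_num

theorem rep_differential (hρ : IsEmbeddingRep ρ) {J : R6} (hJ : J ∈ imagSphere) (c : ℂ) :
    ρ (((slicePoint J c).toCliff * (-J.toCliff)).toOp V) =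
      splitRight (repUnit ρ J) ((-I * c) • 1) ((I * starRingEnd ℂ c) • 1) := by
  rw [Cliff.toOp_mul, Cliff.toOp_neg, hρ.map_mul, map_neg, rep_slicePoint hρ hJ]
  exact splitRight_smul_one_mul_neg (repUnit_mul_self hρ hJ) _ _

end Representation

/-! ### Slice hyperholomorphic functions as holomorphic components -/

section SliceComponents

/-- A real pair that satisfies the Cauchy–Riemann system is a holomorphic function. -/
theorem IsStemPair.differentiableOn {S : Set ℂ} {α β : ℂ → ℝ} (h : IsStemPair S α β) :
    DifferentiableOn ℂ (fun z => (α z + β z * I : ℂ)) S := by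
  intro z hz
  have hα := ofRealCLM.hasFDerivAt.comp z (h.diff_left z hz).hasFDerivAt
  have hβ := (ofRealCLM.hasFDerivAt.comp z (h.diff_right z hz).hasFDerivAt).mul_const I
  have hd := hα.add hβ
  refine (differentiableAt_complex_iff_differentiableAt_real.mpr
    ⟨hd.differentiableAt, ?_⟩).differentiableWithinAt
  have h1 := h.cr_left z hz
  have h2 := h.cr_right z hz
  rw [hd.fderiv]
  apply Complex.ext
  · simp
    linarith
  · simp
    linarith

theorem IsStemPair.apply {S : Set ℂ} {α β : ℂ → Cliff ℝ} (h : IsStemPair S α β)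
    (A : Finset (Fin 5)) : IsStemPair S (fun z => α z A) (fun z => β z A) := by
  let pr : Cliff ℝ →L[ℝ] ℝ := ContinuousLinearMap.proj (R := ℝ) (φ := fun _ : Finset (Fin 5) => ℝ) A
  have hfd : ∀ (u : ℂ → Cliff ℝ) z v, DifferentiableAt ℝ u z →
      fderiv ℝ (fun z => u z A) z v = (fderiv ℝ u z v) A := fun u z v hu => by
    have := (pr.hasFDerivAt.comp z hu.hasFDerivAt).fderiv
    change fderiv ℝ (fun z => u z A) z = _ at this
    rw [this]
    rfl
  refine ⟨fun z hz => (pr.differentiableAt.comp z (h.diff_left z hz)),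
    fun z hz => (pr.differentiableAt.comp z (h.diff_right z hz)), fun z hz => ?_, fun z hz => ?_,
    fun z hz => ?_, fun z hz => ?_⟩
  · exact congrFun (h.even z hz) A
  · exact congrFun (h.odd z hz) A
  · rw [hfd _ _ _ (h.diff_left z hz), hfd _ _ _ (h.diff_right z hz)]
    exact congrFun (h.cr_left z hz) A
  · rw [hfd _ _ _ (h.diff_left z hz), hfd _ _ _ (h.diff_right z hz)]
    exact congrFun (h.cr_right z hz) A

/-- The parity of `α` and `β` identifies the value on the part where `J` acts as `-i` with the
holomorphic function at `z̄`. -/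
theorem IsStemPair.conj_apply {W : Set R6} {α β : ℂ → ℝ} (h : IsStemPair (stemDomain W) α β)
    {z : ℂ} (hz : z ∈ stemDomain W) :
    (α (starRingEnd ℂ z) + β (starRingEnd ℂ z) * I : ℂ) = α z - β z * I := by
  rw [← h.even z hz, h.odd z hz]
  push_cast
  ring

variable {V : Type*} [NormedAddCommGroup V] [NormedSpace ℝ V]
  {𝒜 : Type*} [NormedRing 𝒜] [NormedAlgebra ℂ 𝒜]
  {ρ : Cliff (V →L[ℝ] V) →L[ℝ] 𝒜} {T : Fin 6 → V →L[ℝ] V}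

variable (ρ) in
/-- In the representation `ρ`, the function `f` has the holomorphic components `G i` with respect to
the elements `e i`. -/
def HasSliceComponents {ι : Type*} [Fintype ι] (W : Set R6) (f : R6 → Cliff ℝ) (G : ι → ℂ → ℂ)
    (e : ι → 𝒜) : Prop :=
  (∀ i, DifferentiableOn ℂ (G i) (stemDomain W)) ∧
    ∀ J ∈ imagSphere, ∀ z ∈ stemDomain W, ρ ((f (slicePoint J z)).toOp V) =
      ∑ i, splitRight (repUnit ρ J) (G i z • 1) (G i (starRingEnd ℂ z) • 1) * e i

theorem IsIntrinsicSliceHyperholomorphic.exists_component (hρ : IsEmbeddingRep ρ) {W : Set R6}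
    {f : R6 → Cliff ℝ} (hf : IsIntrinsicSliceHyperholomorphic W f) :
    ∃ F : ℂ → ℂ, HasSliceComponents ρ W f (fun _ : Unit => F) (fun _ => 1) := by
  obtain ⟨α, β, h, hrep⟩ := hf.rep
  refine ⟨fun z => α z + β z * I, fun _ => h.differentiableOn, fun J hJ z hz => ?_⟩
  rw [hrep z hz J hJ, rep_slice_value hρ, ← h.conj_apply hz]
  simp

/-- Expanding `α` and `β` in the basis gives real Cauchy–Riemann pairs. The `e_A` are kept on the
right, so that `J` never has to be moved past them. -/
theorem IsLeftSliceHyperholomorphic.exists_components (hρ : IsEmbeddingRep ρ) {W : Set R6}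
    {f : R6 → Cliff ℝ} (hf : IsLeftSliceHyperholomorphic W f) :
    ∃ (G : Finset (Fin 5) → ℂ → ℂ) (e : Finset (Fin 5) → 𝒜), HasSliceComponents ρ W f G e := by
  obtain ⟨α, β, h, hrep⟩ := hf.rep
  refine ⟨fun A z => α z A + β z A * I, fun A => ρ ((Cliff.mono A 1).toOp V),
    fun A => (h.apply A).differentiableOn, fun J hJ z hz => ?_⟩
  have hsum : f (slicePoint J z) =
      ∑ A, (Cliff.mono ∅ (α z A) + J.toCliff * Cliff.mono ∅ (β z A)) * Cliff.mono A 1 := by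
    simp only [add_mul, mul_assoc, Cliff.mono_empty_mul_mono, mul_one, Finset.sum_add_distrib,
      ← Finset.mul_sum, Cliff.sum_mono]
    exact hrep z hz J hJ
  rw [hsum, Cliff.toOp_sum, map_sum]
  refine Finset.sum_congr rfl fun A _ => ?_
  rw [Cliff.toOp_mul, hρ.map_mul, rep_slice_value hρ, ← (h.apply A).conj_apply hz]

theorem HasSliceComponents.mul (hρ : IsEmbeddingRep ρ) {ι : Type*} [Fintype ι] {Wf Wg : Set R6}
    {f g : R6 → Cliff ℝ} {F : ℂ → ℂ} {G : ι → ℂ → ℂ} {e : ι → 𝒜}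
    (hf : HasSliceComponents ρ Wf f (fun _ : Unit => F) (fun _ => 1))
    (hg : HasSliceComponents ρ Wg g G e) :
    HasSliceComponents ρ (Wf ∩ Wg) (fun x => f x * g x) (fun i z => F z * G i z) e := by
  have hl : stemDomain (Wf ∩ Wg) ⊆ stemDomain Wf := fun z hz J hJ => (hz J hJ).1
  have hr : stemDomain (Wf ∩ Wg) ⊆ stemDomain Wg := fun z hz J hJ => (hz J hJ).2
  refine ⟨fun i => ((hf.1 ()).mono hl).mul ((hg.1 i).mono hr), fun J hJ z hz => ?_⟩
  rw [Cliff.toOp_mul, hρ.map_mul, hf.2 J hJ z (hl hz), hg.2 J hJ z (hr hz)]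
  simp only [Finset.univ_unique, Finset.sum_singleton, mul_one, Finset.mul_sum, ← mul_assoc]
  refine Finset.sum_congr rfl fun i _ => ?_
  rw [splitRight_mul (repUnit_mul_self hρ hJ) (commute_smul_one _ _) (commute_smul_one _ _)]
  simp only [smul_mul_smul_comm, one_mul]

end SliceComponents

/-! ### The functional calculi as area integrals -/

section Calculus

variable {V : Type*} [NormedAddCommGroup V] [NormedSpace ℝ V]
  {𝒜 : Type*} [NormedRing 𝒜] [NormedAlgebra ℂ 𝒜]
  {ρ : Cliff (V →L[ℝ] V) →L[ℝ] 𝒜} {T : Fin 6 → V →L[ℝ] V}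

theorem quadSpectrum_subset_stemDomain (hρ : IsEmbeddingRep ρ) (hT : ∀ i j, Commute (T i) (T j))
    {U : Set R6} (hU : AxiallySymmetric U) (hTU : sSpectrum T ⊆ U) {J : R6} (hJ : J ∈ imagSphere) :
    quadSpectrum (repTrace ρ T) (repNorm ρ T) ⊆ stemDomain U := by
  have hunit : ∀ z ∉ stemDomain U, IsUnit (Qc T (slicePoint J z)) := fun z hz =>
    by_contra fun h => hz (stemDomain_eq_sliceOf hU hJ ▸ hTU h)
  intro z hz
  by_contra hzU
  exact hz (isUnit_quadPencil hρ hT hJ (hunit z hzU)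
    (hunit _ fun h => hzU (by simpa using conj_mem_stemDomain h)))

theorem IsAdmissible.stemDomain_facts (hρ : IsEmbeddingRep ρ) (hT : ∀ i j, Commute (T i) (T j))
    {W U : Set R6} {J : R6} {m : ℕ} {γ : Fin m → ℝ → ℂ} (hadm : IsAdmissible T W U J γ) :
    IsOpen (stemDomain U) ∧ Bornology.IsBounded (stemDomain U) ∧
      quadSpectrum (repTrace ρ T) (repNorm ρ T) ⊆ stemDomain U ∧ stemDomain U ⊆ stemDomain W := by
  have hΩe := stemDomain_eq_sliceOf hadm.cauchy.symm hadm.unit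
  refine ⟨hΩe ▸ isOpen_sliceOf hadm.cauchy.isOpen J,
    hΩe ▸ isBounded_sliceOf hadm.bounded hadm.unit,
    quadSpectrum_subset_stemDomain hρ hT hadm.cauchy.symm hadm.spectrum_subset hadm.unit,
    fun z hz I hI => hadm.closure_subset (subset_closure (hz I hI))⟩

/-- Being bounded below, `ρ` preserves non-integrability too, so it passes through the integral
without any integrability hypothesis. -/
theorem IsEmbeddingRep.map_intervalIntegral [CompleteSpace V] [CompleteSpace 𝒜]
    (hρ : IsEmbeddingRep ρ) (u : ℝ → Cliff (V →L[ℝ] V)) :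
    ρ (∫ t in (0 : ℝ)..1, u t) = ∫ t in (0 : ℝ)..1, ρ (u t) := by
  obtain ⟨K, hK⟩ := hρ.antilipschitz
  rw [intervalIntegral.integral_of_le zero_le_one, intervalIntegral.integral_of_le zero_le_one,
    ρ.integral_comp_comm' hK]

theorem intervalIntegral_smul_mul_add [CompleteSpace 𝒜] {X Y : ℝ → 𝒜}
    (hX : IntervalIntegrable X volume 0 1) (hY : IntervalIntegrable Y volume 0 1) (c d : ℂ)
    (p r e : 𝒜) :
    ∫ t in (0 : ℝ)..1, (c • X t * p + d • Y t * r) * e =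
      (c • (∫ t in (0 : ℝ)..1, X t) * p + d • (∫ t in (0 : ℝ)..1, Y t) * r) * e := by
  have h (L M : 𝒜 →L[ℂ] 𝒜) : ∫ t in (0 : ℝ)..1, (L (X t) + M (Y t)) =
      L (∫ t in (0 : ℝ)..1, X t) + M (∫ t in (0 : ℝ)..1, Y t) := by
    rw [intervalIntegral.integral_add ⟨L.integrable_comp hX.1, L.integrable_comp hX.2⟩
      ⟨M.integrable_comp hY.1, M.integrable_comp hY.2⟩, L.intervalIntegral_comp_comm hX,
      M.intervalIntegral_comp_comm hY]
  have h1 := h (c • (ContinuousLinearMap.mul ℂ 𝒜).flip (p * e))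
    (d • (ContinuousLinearMap.mul ℂ 𝒜).flip (r * e))
  simpa [add_mul, mul_assoc] using h1

theorem intervalIntegral_mul_smul_add [CompleteSpace 𝒜] {X Y : ℝ → 𝒜}
    (hX : IntervalIntegrable X volume 0 1) (hY : IntervalIntegrable Y volume 0 1) (c d : ℂ)
    (p r : 𝒜) :
    ∫ t in (0 : ℝ)..1, (p * c • X t + r * d • Y t) =
      p * c • (∫ t in (0 : ℝ)..1, X t) + r * d • (∫ t in (0 : ℝ)..1, Y t) := by
  have h (L M : 𝒜 →L[ℂ] 𝒜) : ∫ t in (0 : ℝ)..1, (L (X t) + M (Y t)) =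
      L (∫ t in (0 : ℝ)..1, X t) + M (∫ t in (0 : ℝ)..1, Y t) := by
    rw [intervalIntegral.integral_add ⟨L.integrable_comp hX.1, L.integrable_comp hX.2⟩
      ⟨M.integrable_comp hY.1, M.integrable_comp hY.2⟩, L.intervalIntegral_comp_comm hX,
      M.intervalIntegral_comp_comm hY]
  have h1 := h (c • (ContinuousLinearMap.mul ℂ 𝒜) p) (d • (ContinuousLinearMap.mul ℂ 𝒜) r)
  simpa using h1

/-- What the contour of an admissible domain provides in the complex plane, for a function `h` that
is holomorphic off the spectrum. -/
theorem IsAdmissible.contour_facts [CompleteSpace 𝒜] (hρ : IsEmbeddingRep ρ)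
    (hT : ∀ i j, Commute (T i) (T j)) {W U : Set R6} {J : R6} {m : ℕ} {γ : Fin m → ℝ → ℂ}
    (hW : IsOpen W) (hWs : AxiallySymmetric W) (hadm : IsAdmissible T W U J γ) {h : ℂ → 𝒜}
    (hh : DifferentiableOn ℂ h (stemDomain W \ quadSpectrum (repTrace ρ T) (repNorm ρ T)))
    {φ : ℂ → ℂ} (hφ : IsCutoff (quadSpectrum (repTrace ρ T) (repNorm ρ T)) (stemDomain U) φ) :
    (∀ k, IntervalIntegrable (fun t => deriv (γ k) t • h (γ k t)) volume 0 1) ∧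
    (∀ k, IntervalIntegrable (fun t => starRingEnd ℂ (deriv (γ k) t) • h (starRingEnd ℂ (γ k t)))
      volume 0 1) ∧
    ∑ k, ∫ t in (0 : ℝ)..1, deriv (γ k) t • h (γ k t) = -(2 * I) • ∫ w, dbar φ w • h w ∧
    ∑ k, ∫ t in (0 : ℝ)..1, starRingEnd ℂ (deriv (γ k) t) • h (starRingEnd ℂ (γ k t)) =
      (2 * I) • ∫ w, dbar φ w • h w := by
  have hJ := hadm.unit
  have hΩe := stemDomain_eq_sliceOf hadm.cauchy.symm hJ
  have hWe := stemDomain_eq_sliceOf hWs hJ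
  have hΩ : IsOpen (stemDomain U) := hΩe ▸ isOpen_sliceOf hadm.cauchy.isOpen J
  have hWo : IsOpen (stemDomain W) := hWe ▸ isOpen_sliceOf hW J
  have hΩb : Bornology.IsBounded (stemDomain U) := hΩe ▸ isBounded_sliceOf hadm.bounded hJ
  have hΩW : closure (stemDomain U) ⊆ stemDomain W := by
    rw [hΩe, hWe]
    exact (closure_sliceOf_subset U J).trans fun z hz => hadm.closure_subset hz
  have hbd := hadm.boundary
  have hor := hadm.oriented
  rw [← hΩe] at hbd hor
  have hσ := isClosed_quadSpectrum (repTrace ρ T) (repNorm ρ T)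
  have hσU := quadSpectrum_subset_stemDomain hρ hT hadm.cauchy.symm hadm.spectrum_subset hJ
  have hfr : frontier (stemDomain U) ⊆
      stemDomain W \ quadSpectrum (repTrace ρ T) (repNorm ρ T) := fun z hz =>
    ⟨hΩW (frontier_subset_closure hz), fun h => (hΩ.frontier_eq ▸ hz).2 (hσU h)⟩
  have hcj : ∀ z ∈ stemDomain U, starRingEnd ℂ z ∈ stemDomain U := fun z => conj_mem_stemDomain
  exact ⟨fun k => intervalIntegrable_smul_comp (hbd.jordan k).continuousOn
      (hbd.jordan k).intervalIntegrable_deriv (fun t ht => hfr (hbd.mem_frontier k ht))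
      hh.continuousOn,
    fun k => intervalIntegrable_smul_comp
      (continuous_conj.comp_continuousOn (hbd.jordan k).continuousOn)
      (intervalIntegrable_conj (hbd.jordan k).intervalIntegrable_deriv)
      (fun t ht => hfr (conj_mem_frontier hcj (hbd.mem_frontier k ht))) hh.continuousOn,
    boundary_integral_eq hbd hor hΩ hΩb hWo hΩW hσ hh hφ,
    conj_boundary_integral_eq hbd hor hΩ hΩb hcj hWo hΩW hσ hh hφ⟩

theorem IsAdmissible.mem_stemDomain {W U : Set R6} {J : R6} {m : ℕ} {γ : Fin m → ℝ → ℂ}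
    (hWs : AxiallySymmetric W) (hadm : IsAdmissible T W U J γ) (k : Fin m) {t : ℝ}
    (ht : t ∈ Icc (0 : ℝ) 1) :
    γ k t ∈ stemDomain W ∧ IsUnit (Qc T (slicePoint J (γ k t))) ∧
      IsUnit (Qc T (slicePoint J (starRingEnd ℂ (γ k t)))) := by
  have hJ := hadm.unit
  have hΩe := stemDomain_eq_sliceOf hadm.cauchy.symm hJ
  have hfr := hadm.boundary.mem_frontier k ht
  have hnot : γ k t ∉ stemDomain U := by
    rw [hΩe]
    exact ((isOpen_sliceOf hadm.cauchy.isOpen J).frontier_eq ▸ hfr).2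
  have hunit : ∀ z ∉ stemDomain U, IsUnit (Qc T (slicePoint J z)) := fun z hz =>
    by_contra fun h => hz (hΩe ▸ hadm.spectrum_subset h)
  refine ⟨?_, hunit _ hnot, hunit _ fun h => hnot (by simpa using conj_mem_stemDomain h)⟩
  rw [stemDomain_eq_sliceOf hWs hJ]
  exact hadm.closure_subset (closure_sliceOf_subset U J (frontier_subset_closure hfr))

theorem differentiableOn_smul_repKernel [CompleteSpace 𝒜] (P : FineOp) {S : Set ℂ} {G : ℂ → ℂ}
    (hG : DifferentiableOn ℂ G S) :
    DifferentiableOn ℂ (fun z => G z • P.repKernel ρ T z)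
      (S \ quadSpectrum (repTrace ρ T) (repNorm ρ T)) :=
  (hG.mono sdiff_subset).smul ((P.differentiableOn_kernel _ _ _).mono fun _ hz => hz.2)

/-- The integrand splits into a `dz` part at `γ` and a `dz̄` part at the conjugate of `γ`. Both give
the same multiple of one area integral, and as the idempotents add up to `1`, no trace of `J`
remains. -/
theorem rep_leftIntegral [CompleteSpace V] [CompleteSpace 𝒜] (hρ : IsEmbeddingRep ρ)
    (hT : ∀ i j, Commute (T i) (T j)) {W U : Set R6} {J : R6} {m : ℕ} {γ : Fin m → ℝ → ℂ}
    (hW : IsOpen W) (hWs : AxiallySymmetric W) (hadm : IsAdmissible T W U J γ) {ι : Type*}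
    [Fintype ι] {f : R6 → Cliff ℝ} {G : ι → ℂ → ℂ} {e : ι → 𝒜}
    (hf : HasSliceComponents ρ W f G e) (P : FineOp) {φ : ℂ → ℂ}
    (hφ : IsCutoff (quadSpectrum (repTrace ρ T) (repNorm ρ T)) (stemDomain U) φ) :
    ρ (leftIntegral (P.resolventLeft T) f J γ) =
      ∑ i, (-(π : ℂ)⁻¹ • ∫ w, dbar φ w • G i w • P.repKernel ρ T w) * e i := by
  have hJ := hadm.unit
  have hj := repUnit_mul_self hρ hJ
  have hfacts := fun i => hadm.contour_facts hρ hT hW hWs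
    (differentiableOn_smul_repKernel (ρ := ρ) (T := T) P (hf.1 i)) hφ
  set j := repUnit ρ J
  have hint : ∀ k, ∀ t ∈ Icc (0 : ℝ) 1,
      ρ (P.resolventLeft T (slicePoint J (γ k t)) *
        ((slicePoint J (deriv (γ k) t)).toCliff * (-J.toCliff)).toOp V *
        (f (slicePoint J (γ k t))).toOp V) =
      ∑ i, (-I • (deriv (γ k) t • G i (γ k t) • P.repKernel ρ T (γ k t)) * idemPos j +
        I • (starRingEnd ℂ (deriv (γ k) t) • G i (starRingEnd ℂ (γ k t)) •
          P.repKernel ρ T (starRingEnd ℂ (γ k t))) * idemNeg j) * e i := by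
    intro k t ht
    obtain ⟨h0, h1, h2⟩ := hadm.mem_stemDomain hWs k ht
    rw [hρ.map_mul, hρ.map_mul, rep_resolventLeft hρ hT hJ h1 h2, rep_differential hρ hJ,
      hf.2 J hJ _ h0, splitRight_mul hj (commute_smul_one _ _) (commute_smul_one _ _),
      Finset.mul_sum]
    refine Finset.sum_congr rfl fun i _ => ?_
    rw [← mul_assoc, splitRight_mul hj (commute_smul_one _ _) (commute_smul_one _ _), splitRight]
    simp only [mul_smul_comm, mul_one, smul_smul]
    congr 4 <;> ring
  have hk : ∀ k, ∫ t in (0 : ℝ)..1, ρ (P.resolventLeft T (slicePoint J (γ k t)) *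
        ((slicePoint J (deriv (γ k) t)).toCliff * (-J.toCliff)).toOp V *
        (f (slicePoint J (γ k t))).toOp V) =
      ∑ i, (-I • (∫ t in (0 : ℝ)..1, deriv (γ k) t • G i (γ k t) • P.repKernel ρ T (γ k t))
          * idemPos j +
        I • (∫ t in (0 : ℝ)..1, starRingEnd ℂ (deriv (γ k) t) • G i (starRingEnd ℂ (γ k t)) •
          P.repKernel ρ T (starRingEnd ℂ (γ k t))) * idemNeg j) * e i := by
    intro k
    rw [intervalIntegral.integral_congr (g := fun t => ∑ i, (-I • (deriv (γ k) t • G i (γ k t) •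
      P.repKernel ρ T (γ k t)) * idemPos j + I • (starRingEnd ℂ (deriv (γ k) t) •
      G i (starRingEnd ℂ (γ k t)) • P.repKernel ρ T (starRingEnd ℂ (γ k t))) * idemNeg j) * e i)
      fun t ht => hint k t (uIcc_of_le (zero_le_one' ℝ) ▸ ht)]
    rw [intervalIntegral.integral_finsetSum]
    · exact Finset.sum_congr rfl fun i _ => intervalIntegral_smul_mul_add ((hfacts i).1 k)
        ((hfacts i).2.1 k) _ _ _ _ _
    · intro i _
      exact (((((hfacts i).1 k).smul (-I)).mul_const _).add
        ((((hfacts i).2.1 k).smul I).mul_const _)).mul_const _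
  rw [leftIntegral, IsEmbeddingRep.map_real_smul, map_sum,
    Finset.sum_congr rfl fun k _ => (hρ.map_intervalIntegral _).trans (hk k), Finset.sum_comm,
    Finset.smul_sum]
  refine Finset.sum_congr rfl fun i _ => ?_
  rw [← Finset.sum_mul, Finset.sum_add_distrib, ← Finset.sum_mul, ← Finset.sum_mul,
    ← Finset.smul_sum, ← Finset.smul_sum, (hfacts i).2.2.1, (hfacts i).2.2.2, ← smul_mul_assoc]
  congr 1
  set M := ∫ w, dbar φ w • G i w • P.repKernel ρ T w
  -- The opposite signs of `-i dz` and `i dz̄` are compensated by the opposite orientations of the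
  -- two contours.
  have hs : -I • -(2 * I) • M * idemPos j + I • (2 * I) • M * idemNeg j =
      (-2 : ℂ) • splitRight j M M := by
    have h1 : -I * -(2 * I) = -2 := by linear_combination 2 * I_mul_I
    have h2 : I * (2 * I) = -2 := by linear_combination 2 * I_mul_I
    rw [smul_smul, smul_smul, h1, h2, splitRight, smul_add, smul_mul_assoc, smul_mul_assoc]
  rw [hs, splitRight_self, smul_smul]
  congr 1
  push_cast
  field_simp

theorem rep_rightIntegral [CompleteSpace V] [CompleteSpace 𝒜] (hρ : IsEmbeddingRep ρ)
    (hT : ∀ i j, Commute (T i) (T j)) {W U : Set R6} {J : R6} {m : ℕ} {γ : Fin m → ℝ → ℂ}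
    (hW : IsOpen W) (hWs : AxiallySymmetric W) (hadm : IsAdmissible T W U J γ)
    {f : R6 → Cliff ℝ} {F : ℂ → ℂ}
    (hf : HasSliceComponents ρ W f (fun _ : Unit => F) (fun _ => 1)) (P : FineOp) {φ : ℂ → ℂ}
    (hφ : IsCutoff (quadSpectrum (repTrace ρ T) (repNorm ρ T)) (stemDomain U) φ) :
    ρ (rightIntegral (P.resolventRight T) f J γ) =
      -(π : ℂ)⁻¹ • ∫ w, dbar φ w • F w • P.repKernel ρ T w := by
  have hJ := hadm.unit
  have hj := repUnit_mul_self hρ hJ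
  have hfacts := hadm.contour_facts hρ hT hW hWs
    (differentiableOn_smul_repKernel (ρ := ρ) (T := T) P (hf.1 ())) hφ
  set j := repUnit ρ J
  have hint : ∀ k, ∀ t ∈ Icc (0 : ℝ) 1,
      ρ ((f (slicePoint J (γ k t))).toOp V *
        ((slicePoint J (deriv (γ k) t)).toCliff * (-J.toCliff)).toOp V *
        P.resolventRight T (slicePoint J (γ k t))) =
      idemPos j * -I • (deriv (γ k) t • F (γ k t) • P.repKernel ρ T (γ k t)) +
        idemNeg j * I • (starRingEnd ℂ (deriv (γ k) t) • F (starRingEnd ℂ (γ k t)) •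
          P.repKernel ρ T (starRingEnd ℂ (γ k t))) := by
    intro k t ht
    obtain ⟨h0, h1, h2⟩ := hadm.mem_stemDomain hWs k ht
    have hc := fun c d : ℂ => splitRight_eq_splitLeft (commute_smul_one c j) (commute_smul_one d j)
    rw [hρ.map_mul, hρ.map_mul, rep_resolventRight hρ hT hJ h1 h2, rep_differential hρ hJ,
      hf.2 J hJ _ h0]
    simp only [Finset.univ_unique, Finset.sum_singleton, mul_one]
    rw [splitRight_mul hj (commute_smul_one _ _) (commute_smul_one _ _)]
    simp only [smul_mul_smul_comm, mul_one]
    rw [hc, splitLeft_mul hj (commute_smul_one _ _) (commute_smul_one _ _), splitLeft]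
    simp only [smul_mul_assoc, one_mul, smul_smul]
    congr 3 <;> ring_nf
  rw [rightIntegral, IsEmbeddingRep.map_real_smul, map_sum]
  have hk : ∀ k, ∫ t in (0 : ℝ)..1, ρ ((f (slicePoint J (γ k t))).toOp V *
        ((slicePoint J (deriv (γ k) t)).toCliff * (-J.toCliff)).toOp V *
        P.resolventRight T (slicePoint J (γ k t))) =
      idemPos j * -I • (∫ t in (0 : ℝ)..1, deriv (γ k) t • F (γ k t) • P.repKernel ρ T (γ k t)) +
        idemNeg j * I • (∫ t in (0 : ℝ)..1, starRingEnd ℂ (deriv (γ k) t) •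
          F (starRingEnd ℂ (γ k t)) • P.repKernel ρ T (starRingEnd ℂ (γ k t))) := by
    intro k
    rw [← intervalIntegral_mul_smul_add (hfacts.1 k) (hfacts.2.1 k)]
    exact intervalIntegral.integral_congr fun t ht => hint k t (uIcc_of_le (zero_le_one' ℝ) ▸ ht)
  rw [Finset.sum_congr rfl fun k _ => (hρ.map_intervalIntegral _).trans (hk k),
    Finset.sum_add_distrib, ← Finset.mul_sum, ← Finset.mul_sum, ← Finset.smul_sum,
    ← Finset.smul_sum, hfacts.2.2.1, hfacts.2.2.2]
  set M := ∫ w, dbar φ w • F w • P.repKernel ρ T w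
  have hs : idemPos j * -I • -(2 * I) • M + idemNeg j * I • (2 * I) • M =
      (-2 : ℂ) • splitLeft j M M := by
    have h1 : -I * -(2 * I) = -2 := by linear_combination 2 * I_mul_I
    have h2 : I * (2 * I) = -2 := by linear_combination 2 * I_mul_I
    rw [smul_smul, smul_smul, h1, h2, splitLeft, smul_add, mul_smul_comm, mul_smul_comm]
  rw [hs, splitLeft_self, smul_smul]
  congr 1
  push_cast
  field_simp

end Calculus

/-- The product of an intrinsic and a left slice hyperholomorphic function. -/
theorem IsIntrinsicSliceHyperholomorphic.mul {Wf Wg : Set R6} {f g : R6 → Cliff ℝ}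
    (hf : IsIntrinsicSliceHyperholomorphic Wf f) (hg : IsLeftSliceHyperholomorphic Wg g) :
    IsLeftSliceHyperholomorphic (Wf ∩ Wg) (fun x => f x * g x) := by
  refine ⟨hf.isOpen.inter hg.isOpen, fun z I hI J hJ h =>
    ⟨hf.symm z I hI J hJ h.1, hg.symm z I hI J hJ h.2⟩, ?_⟩
  obtain ⟨a, b, hab, hfr⟩ := hf.rep
  obtain ⟨α, β, hαβ, hgr⟩ := hg.rep
  have hl : stemDomain (Wf ∩ Wg) ⊆ stemDomain Wf := fun z hz J hJ => (hz J hJ).1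
  have hr : stemDomain (Wf ∩ Wg) ⊆ stemDomain Wg := fun z hz J hJ => (hz J hJ).2
  have hd1 : ∀ z ∈ stemDomain (Wf ∩ Wg), HasFDerivAt (fun z => a z • α z - b z • β z)
      ((a z • fderiv ℝ α z + (fderiv ℝ a z).smulRight (α z)) -
        (b z • fderiv ℝ β z + (fderiv ℝ b z).smulRight (β z))) z := fun z hz =>
    ((hab.diff_left z (hl hz)).hasFDerivAt.smul (hαβ.diff_left z (hr hz)).hasFDerivAt).sub
      ((hab.diff_right z (hl hz)).hasFDerivAt.smul (hαβ.diff_right z (hr hz)).hasFDerivAt)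
  have hd2 : ∀ z ∈ stemDomain (Wf ∩ Wg), HasFDerivAt (fun z => a z • β z + b z • α z)
      ((a z • fderiv ℝ β z + (fderiv ℝ a z).smulRight (β z)) +
        (b z • fderiv ℝ α z + (fderiv ℝ b z).smulRight (α z))) z := fun z hz =>
    ((hab.diff_left z (hl hz)).hasFDerivAt.smul (hαβ.diff_right z (hr hz)).hasFDerivAt).add
      ((hab.diff_right z (hl hz)).hasFDerivAt.smul (hαβ.diff_left z (hr hz)).hasFDerivAt)
  -- The components of `(a + J b) (α + J β)`, where the real `a` and `b` commute with `J` and `J² =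
  -- -1`.
  refine ⟨fun z => a z • α z - b z • β z, fun z => a z • β z + b z • α z,
    ⟨fun z hz => (hd1 z hz).differentiableAt, fun z hz => (hd2 z hz).differentiableAt,
      fun z hz => ?_, fun z hz => ?_, fun z hz => ?_, fun z hz => ?_⟩, fun z hz J hJ => ?_⟩
  · rw [← hab.even z (hl hz), ← hαβ.even z (hr hz), hab.odd z (hl hz), hαβ.odd z (hr hz),
      neg_smul_neg]
  · rw [← hab.even z (hl hz), ← hαβ.even z (hr hz), hab.odd z (hl hz), hαβ.odd z (hr hz)]
    module
  · have h1 := sub_eq_zero.mp (hab.cr_left z (hl hz))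
    have h2 := eq_neg_of_add_eq_zero_left (hab.cr_right z (hl hz))
    have h3 := sub_eq_zero.mp (hαβ.cr_left z (hr hz))
    have h4 := eq_neg_of_add_eq_zero_left (hαβ.cr_right z (hr hz))
    rw [(hd1 z hz).fderiv, (hd2 z hz).fderiv]
    simp only [add_apply, sub_apply, smul_apply, ContinuousLinearMap.smulRight_apply, h1, h2, h3,
      h4]
    module
  · have h1 := sub_eq_zero.mp (hab.cr_left z (hl hz))
    have h2 := eq_neg_of_add_eq_zero_left (hab.cr_right z (hl hz))
    have h3 := sub_eq_zero.mp (hαβ.cr_left z (hr hz))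
    have h4 := eq_neg_of_add_eq_zero_left (hαβ.cr_right z (hr hz))
    rw [(hd1 z hz).fderiv, (hd2 z hz).fderiv]
    simp only [add_apply, sub_apply, smul_apply, ContinuousLinearMap.smulRight_apply, h1, h2, h3,
      h4]
    module
  · have hJJ : J.toCliff * (J.toCliff * β z) = -β z := by
      rw [← mul_assoc, toCliff_mul_self hJ, neg_one_mul]
    simp only [hfr z (hl hz) J hJ, hgr z (hr hz) J hJ, add_mul, mul_assoc, Cliff.mono_empty_mul,
      mul_add, cliff_mul_smul, hJJ]
    module

/-! ### The product rule -/

section ProductRule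

variable {V : Type*} [NormedAddCommGroup V] [NormedSpace ℝ V]
  {𝒜 : Type*} [NormedRing 𝒜] [NormedAlgebra ℂ 𝒜] [CompleteSpace 𝒜]
  {ρ : Cliff (V →L[ℝ] V) →L[ℝ] 𝒜} {T : Fin 6 → V →L[ℝ] V}

variable (ρ T) in
/-- `(P F)(T)` in the representation `ρ`, as an area integral with the cutoff `φ`. -/
noncomputable def cutoffCalculus (φ : ℂ → ℂ) (P : FineOp) (F : ℂ → ℂ) : 𝒜 :=
  -(π : ℂ)⁻¹ • ∫ w, dbar φ w • F w • P.repKernel ρ T w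

/-- All that is kept of `U`, `J` and the contour is an open set in which the cutoff must be
supported. Any smaller support will do as well, so operators computed from different domains can be
compared. -/
theorem IsLeftCalculus.exists_domain [CompleteSpace V] (hρ : IsEmbeddingRep ρ)
    (hT : ∀ i j, Commute (T i) (T j)) {W : Set R6} (hW : IsOpen W) (hWs : AxiallySymmetric W) {ι : Type*} [Fintype ι]
    {f : R6 → Cliff ℝ} {G : ι → ℂ → ℂ} {e : ι → 𝒜} (hf : HasSliceComponents ρ W f G e)
    {P : FineOp} {A : Cliff (V →L[ℝ] V)} (hA : IsLeftCalculus P T W f A) :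
    ∃ Ω, IsOpen Ω ∧ Bornology.IsBounded Ω ∧ quadSpectrum (repTrace ρ T) (repNorm ρ T) ⊆ Ω ∧
      Ω ⊆ stemDomain W ∧ ∀ φ, IsCutoff (quadSpectrum (repTrace ρ T) (repNorm ρ T)) Ω φ →
        ρ A = ∑ i, cutoffCalculus ρ T φ P (G i) * e i := by
  obtain ⟨U, J, m, γ, hadm, rfl⟩ := hA
  obtain ⟨h1, h2, h3, h4⟩ := hadm.stemDomain_facts hρ hT
  exact ⟨stemDomain U, h1, h2, h3, h4, fun φ hφ => rep_leftIntegral hρ hT hW hWs hadm hf P hφ⟩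

theorem IsIntrinsicCalculus.exists_domain [CompleteSpace V] (hρ : IsEmbeddingRep ρ)
    (hT : ∀ i j, Commute (T i) (T j)) {W : Set R6} (hW : IsOpen W) (hWs : AxiallySymmetric W)
    {f : R6 → Cliff ℝ} {F : ℂ → ℂ}
    (hf : HasSliceComponents ρ W f (fun _ : Unit => F) (fun _ => 1))
    {P : FineOp} {A : Cliff (V →L[ℝ] V)} (hA : IsIntrinsicCalculus P T W f A) :
    ∃ Ω, IsOpen Ω ∧ quadSpectrum (repTrace ρ T) (repNorm ρ T) ⊆ Ω ∧
      ∀ φ, IsCutoff (quadSpectrum (repTrace ρ T) (repNorm ρ T)) Ω φ →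
        ρ A = cutoffCalculus ρ T φ P F := by
  rcases hA with hA | ⟨U, J, m, γ, hadm, rfl⟩
  · obtain ⟨Ω, h1, -, h3, -, h5⟩ := hA.exists_domain hρ hT hW hWs hf
    exact ⟨Ω, h1, h3, fun φ hφ => by simpa using h5 φ hφ⟩
  · obtain ⟨h1, -, h3, -⟩ := hadm.stemDomain_facts hρ hT
    exact ⟨stemDomain U, h1, h3, fun φ hφ => rep_rightIntegral hρ hT hW hWs hadm hf P hφ⟩

/-- The product rule for holomorphic functions, with nested cutoffs. -/
theorem cutoffCalculus_mul (hρ : IsEmbeddingRep ρ) (hT : ∀ i j, Commute (T i) (T j))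
    {Ωf Ωg : Set ℂ} (hΩf : IsOpen Ωf) (hΩg : IsOpen Ωg) {F G : ℂ → ℂ}
    (hF : DifferentiableOn ℂ F Ωf) (hG : DifferentiableOn ℂ G Ωg) {φ ψ : ℂ → ℂ}
    (hψ : IsCutoff (quadSpectrum (repTrace ρ T) (repNorm ρ T)) Ωg ψ)
    (hφ : IsCutoff (tsupport ψ) Ωf φ) :
    cutoffCalculus ρ T ψ .ΔΔ (fun z => F z * G z) =
      cutoffCalculus ρ T φ .ΔΔ F * cutoffCalculus ρ T ψ .id G
      + cutoffCalculus ρ T φ .id F * cutoffCalculus ρ T ψ .ΔΔ G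
      + cutoffCalculus ρ T φ .Δ F * cutoffCalculus ρ T ψ .Δ G
      - cutoffCalculus ρ T φ .ΔD F * cutoffCalculus ρ T ψ .D G
      - cutoffCalculus ρ T φ .D F * cutoffCalculus ρ T ψ .ΔD G := by
  have hc : ∀ P : FineOp, ContinuousOn (P.repKernel ρ T)
      (quadSpectrum (repTrace ρ T) (repNorm ρ T))ᶜ := fun P =>
    (P.differentiableOn_kernel _ _ _).continuousOn
  have hmul := sum_cutoff_integral_mul
    -- The minus signs of the last two products are absorbed into the left kernels.
    (H := ![FineOp.repKernel ρ T .ΔΔ, FineOp.repKernel ρ T .id, FineOp.repKernel ρ T .Δ,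
      -FineOp.repKernel ρ T .ΔD, -FineOp.repKernel ρ T .D])
    (K := ![FineOp.repKernel ρ T .id, FineOp.repKernel ρ T .ΔΔ, FineOp.repKernel ρ T .Δ,
      FineOp.repKernel ρ T .D, FineOp.repKernel ρ T .ΔD])
    (L := FineOp.repKernel ρ T .ΔΔ)
    (isClosed_quadSpectrum (repTrace ρ T) (repNorm ρ T))
    (by
      intro i
      fin_cases i
      exacts [hc .ΔΔ, hc .id, hc .Δ, (hc .ΔD).neg, (hc .D).neg])
    (by
      intro i
      fin_cases i
      exacts [hc .id, hc .ΔΔ, hc .Δ, hc .D, hc .ΔD])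
    (hc _)
    (fun z hz w hw => by
      have := FineOp.kernel_resolvent_equation (commute_repTrace_repNorm hρ hT)
        (commute_repTrace_repConj hρ hT) (commute_repNorm_repConj hρ hT) (repConj_mul_self hρ) hz hw
      rw [Fin.sum_univ_five]
      simpa [FineOp.repKernel, sub_eq_add_neg] using this)
    hΩf hΩg hF hG hψ hφ
  rw [Fin.sum_univ_five] at hmul
  simp only [Fin.isValue, Matrix.cons_val, Pi.neg_apply, smul_neg, integral_neg, neg_mul] at hmul
  have hπ : (π : ℂ) ≠ 0 := ofReal_ne_zero.mpr Real.pi_ne_zero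
  -- Every product of two calculi carries `(-1/π)²`, matched here with the factor `-π` from the
  -- product of area integrals.
  have h2 : cutoffCalculus ρ T ψ .ΔΔ (fun z => F z * G z) = ((π : ℂ)⁻¹ * (π : ℂ)⁻¹) •
      (-(π : ℂ) • ∫ w, dbar ψ w • (F w * G w) • FineOp.repKernel ρ T .ΔΔ w) := by
    rw [cutoffCalculus, smul_smul]
    congr 1
    field_simp
  rw [h2, ← hmul]
  simp only [cutoffCalculus, smul_mul_assoc, mul_smul_comm]
  module

end ProductRule

/-- The eleven operators may come from different domains, units and contours; all are rewritten with
only two cutoffs, after which the rule is proved separately for each component of `g`. -/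
theorem mainTheorem1 {V : Type*} [NormedAddCommGroup V] [NormedSpace ℝ V] [CompleteSpace V]
    (T : Fin 6 → V →L[ℝ] V) (hT : ∀ i j, Commute (T i) (T j))
    (Wf Wg : Set R6) (f g : R6 → Cliff ℝ)
    (hf : IsIntrinsicSliceHyperholomorphic Wf f) (hfT : sSpectrum T ⊆ Wf)
    (hg : IsLeftSliceHyperholomorphic Wg g) (hgT : sSpectrum T ⊆ Wg) :
    IsLeftSliceHyperholomorphic (Wf ∩ Wg) (fun x => f x * g x) ∧
    ∀ ΔΔfg f₁ Df Δf ΔDf ΔΔf g₁ Dg Δg ΔDg ΔΔg : Cliff (V →L[ℝ] V),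
      IsLeftCalculus .ΔΔ T (Wf ∩ Wg) (fun x => f x * g x) ΔΔfg →
      IsIntrinsicCalculus .id T Wf f f₁ →
      IsIntrinsicCalculus .D T Wf f Df →
      IsIntrinsicCalculus .Δ T Wf f Δf →
      IsIntrinsicCalculus .ΔD T Wf f ΔDf →
      IsIntrinsicCalculus .ΔΔ T Wf f ΔΔf →
      IsLeftCalculus .id T Wg g g₁ →
      IsLeftCalculus .D T Wg g Dg →
      IsLeftCalculus .Δ T Wg g Δg →
      IsLeftCalculus .ΔD T Wg g ΔDg →
      IsLeftCalculus .ΔΔ T Wg g ΔΔg →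
      ΔΔfg = ΔΔf * g₁ + f₁ * ΔΔg + Δf * Δg - ΔDf * Dg - Df * ΔDg := by
  have hfg := hf.mul hg
  refine ⟨hfg, ?_⟩
  intro ΔΔfg f₁ Df Δf ΔDf ΔΔf g₁ Dg Δg ΔDg ΔΔg hΔΔfg hf₁ hDf hΔf hΔDf hΔΔf hg₁ hDg hΔg hΔDg hΔΔg
  obtain ⟨𝒜, _, _, _, ρ, h1, h2, h3⟩ := exists_complex_representation (𝔄 := V →L[ℝ] V)
  have hρ : IsEmbeddingRep ρ := ⟨h1, h2, h3⟩
  obtain ⟨F, hF⟩ := hf.exists_component hρ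
  obtain ⟨G, e, hG⟩ := hg.exists_components hρ
  obtain ⟨Ω₀, ho₀, hb₀, hs₀, hd₀, he₀⟩ :=
    hΔΔfg.exists_domain hρ hT hfg.isOpen hfg.symm (hF.mul hρ hG)
  obtain ⟨Ω₁, ho₁, hs₁, he₁⟩ := hf₁.exists_domain hρ hT hf.isOpen hf.symm hF
  obtain ⟨Ω₂, ho₂, hs₂, he₂⟩ := hDf.exists_domain hρ hT hf.isOpen hf.symm hF
  obtain ⟨Ω₃, ho₃, hs₃, he₃⟩ := hΔf.exists_domain hρ hT hf.isOpen hf.symm hF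
  obtain ⟨Ω₄, ho₄, hs₄, he₄⟩ := hΔDf.exists_domain hρ hT hf.isOpen hf.symm hF
  obtain ⟨Ω₅, ho₅, hs₅, he₅⟩ := hΔΔf.exists_domain hρ hT hf.isOpen hf.symm hF
  obtain ⟨Ω₆, ho₆, -, hs₆, -, he₆⟩ := hg₁.exists_domain hρ hT hg.isOpen hg.symm hG
  obtain ⟨Ω₇, ho₇, -, hs₇, -, he₇⟩ := hDg.exists_domain hρ hT hg.isOpen hg.symm hG
  obtain ⟨Ω₈, ho₈, -, hs₈, -, he₈⟩ := hΔg.exists_domain hρ hT hg.isOpen hg.symm hG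
  obtain ⟨Ω₉, ho₉, -, hs₉, -, he₉⟩ := hΔDg.exists_domain hρ hT hg.isOpen hg.symm hG
  obtain ⟨Ω₁₀, ho₁₀, -, hs₁₀, -, he₁₀⟩ := hΔΔg.exists_domain hρ hT hg.isOpen hg.symm hG
  set σ := quadSpectrum (repTrace ρ T) (repNorm ρ T) with hσ
  have hσc : IsCompact σ :=
    Metric.isCompact_of_isClosed_isBounded (isClosed_quadSpectrum _ _) (hb₀.subset hs₀)
  -- Including `Ω₀`, the domain for `f g`, places both sets inside the domains of holomorphy of `F`
  -- and the `G A`. As `Ωg ⊆ Ωf`, there is room for `φ` to equal `1` near the support of `ψ`.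
  set Ωf : Set ℂ := Ω₀ ∩ (Ω₁ ∩ (Ω₂ ∩ (Ω₃ ∩ (Ω₄ ∩ Ω₅)))) with hΩf
  set Ωg : Set ℂ := Ωf ∩ (Ω₆ ∩ (Ω₇ ∩ (Ω₈ ∩ (Ω₉ ∩ Ω₁₀)))) with hΩg
  have hof : IsOpen Ωf :=
    ho₀.inter (ho₁.inter (ho₂.inter (ho₃.inter (ho₄.inter ho₅))))
  have hog : IsOpen Ωg :=
    hof.inter (ho₆.inter (ho₇.inter (ho₈.inter (ho₉.inter ho₁₀))))
  have hσg : σ ⊆ Ωg := fun z hz => ⟨⟨hs₀ hz, hs₁ hz, hs₂ hz, hs₃ hz, hs₄ hz, hs₅ hz⟩, hs₆ hz,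
    hs₇ hz, hs₈ hz, hs₉ hz, hs₁₀ hz⟩
  obtain ⟨ψ, hψ⟩ := exists_isCutoff hσc hog hσg
  obtain ⟨φ, hφ⟩ := exists_isCutoff hψ.hasCompactSupport hof
    (hψ.tsupport_subset.trans inter_subset_left)
  have hφσ : IsCutoff σ Ωf φ := hφ.mono hψ.subset_tsupport Subset.rfl
  have hFd : DifferentiableOn ℂ F Ωf :=
    (hF.1 ()).mono fun z hz J hJ => (hd₀ hz.1 J hJ).1
  have hGd : ∀ A, DifferentiableOn ℂ (G A) Ωg := fun A =>
    (hG.1 A).mono fun z hz J hJ => (hd₀ hz.1.1 J hJ).2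
  refine hρ.injective ?_
  simp only [map_sub, map_add, hρ.map_mul]
  rw [he₀ ψ (hψ.mono Subset.rfl fun z hz => hz.1.1),
    he₁ φ (hφσ.mono Subset.rfl fun z hz => hz.2.1),
    he₂ φ (hφσ.mono Subset.rfl fun z hz => hz.2.2.1),
    he₃ φ (hφσ.mono Subset.rfl fun z hz => hz.2.2.2.1),
    he₄ φ (hφσ.mono Subset.rfl fun z hz => hz.2.2.2.2.1),
    he₅ φ (hφσ.mono Subset.rfl fun z hz => hz.2.2.2.2.2),
    he₆ ψ (hψ.mono Subset.rfl fun z hz => hz.2.1),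
    he₇ ψ (hψ.mono Subset.rfl fun z hz => hz.2.2.1),
    he₈ ψ (hψ.mono Subset.rfl fun z hz => hz.2.2.2.1),
    he₉ ψ (hψ.mono Subset.rfl fun z hz => hz.2.2.2.2.1),
    he₁₀ ψ (hψ.mono Subset.rfl fun z hz => hz.2.2.2.2.2)]
  -- The elements `e A` stand on the far right in every term, so they factor out.
  simp only [Finset.mul_sum, ← Finset.sum_add_distrib, ← Finset.sum_sub_distrib, ← mul_assoc,
    ← add_mul, ← sub_mul]
  refine Finset.sum_congr rfl fun A _ => ?_
  rw [cutoffCalculus_mul hρ hT hof hog hFd (hGd A) hψ hφ]
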